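/- For $\lambda>0$, $\nu>0$ and $x>0$ let \[ \mathcal W^-_{\lambda,\nu}(x)=\Bigl(\frac x2\Bigr)^{\nu}\sum_{n=0}^\infty\frac{(-1)^n (x/2)^{(\lambda+1)n}}{n!\,\Gamma(\lambda n+\nu+1)}, \] and for $a>0$ let $h(u)=\tfrac12(e^u-e^{-\lambda u})-au$ $(u\in\mathbb C)$; a saddle is a zero of $h'$. Suppose that $\lambda>0$ and that $(a,\lambda)$ lies below the double-saddle curve, that is, \[ 0<a<\frac{1+\lambda}{2}\,\lambda^{(1-\lambda)/(1+\lambda)} . \] Then there is exactly one saddle $u_0$ with $0<\operatorname{Im}u_0\le\pi$ such that every saddle $v$ with $|\operatorname{Im}v|\le\pi$ satisfies $|\operatorname{Im}v|\ge\operatorname{Im}u_0$; so there is no real saddle, and $u_0,\overline{u_0}$ is the pair of complex-conjugate saddles of the strip $|\operatorname{Im}u|\le\pi$ nearest to the real axis. Put $h_0''=h''(u_0)$. Then $h_0''\neq0$. There is a function $u(w)$, analytic near $w=0$, with \[ -\tfrac12w^2=h(u(w))-h(u_0),\qquad u(0)=u_0,\qquad u'(0)=\frac1{\sqrt{-h_0''}},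 \] and with $A_k$ $(k\ge0)$ denoting the complex numbers for which the even part of the Taylor series of $du/dw$ at $w=0$ is $\frac{1}{\sqrt{-h_0''}}\sum_{k\ge0}(-1)^kA_kw^{2k}$, one has \[ \mathcal W^-_{\lambda,\nu}(x)\sim\sqrt{\frac{2}{\pi x}}\;\operatorname{Re}\Bigl\{\frac{e^{xh(u_0)}}{\sqrt{h_0''}}\sum_{k\ge0}\frac{(-1)^k(\frac12)_kA_k}{(x/2)^k}\Bigr\}\qquad(x\to+\infty,\ \nu=ax). \] Here square roots are principal, $(\frac12)_k$ is the Pochhammer symbol, and $\sim$ means that for every integer $N\ge0$, as $x\to+\infty$ with $a,\lambda$ fixed, \[ \mathcal W^-_{\lambda,ax}(x)=\sqrt{\frac{2}{\pi x}}\;\operatorname{Re}\Bigl\{\frac{e^{xh(u_0)}}{\sqrt{h_0''}}\sum_{k=0}^{N-1}\frac{(-1)^k(\frac12)_kA_k}{(x/2)^k}\Bigr\}+O\bigl(e^{x\operatorname{Re}h(u_0)}\,x^{-N-1/2}\bigr). \] -/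

import Mathlib

open Filter Topology Asymptotics

/-- The Wright function `W_{λ,μ}(z) = ∑ zⁿ / (n! Γ(λ n + μ))` for real parameters and argument. -/
noncomputable def wright (lam mu z : ℝ) : ℝ :=
  ∑' n : ℕ, z ^ n / ((n.factorial : ℝ) * Real.Gamma (lam * n + mu))

/-- For `λ > 0` the series that defines the Wright function converges (absolutely), so that
the sum in `wright` is the actual sum of the series. -/
theorem summable_wright {lam : ℝ} (hlam : 0 < lam) (mu z : ℝ) :
    Summable fun n : ℕ => z ^ n / ((n.factorial : ℝ) * Real.Gamma (lam * n + mu)) := by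
  have hlim : Tendsto (fun n : ℕ => lam * (n : ℝ) + mu) atTop atTop :=
    tendsto_atTop_add_const_right _ _ (tendsto_natCast_atTop_atTop.const_mul_atTop hlam)
  refine (Real.summable_pow_div_factorial |z|).of_norm_bounded_eventually_nat ?_
  filter_upwards [hlim.eventually_ge_atTop 2] with n hn
  have hG : 1 ≤ Real.Gamma (lam * n + mu) := by
    have h := Real.Gamma_strictMonoOn_Ici.monotoneOn (Set.mem_Ici.2 le_rfl) (Set.mem_Ici.2 hn) hn
    rwa [Real.Gamma_two] at h
  have hf : (0 : ℝ) < n.factorial := by exact_mod_cast n.factorial_pos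
  rw [norm_div, norm_pow, Real.norm_eq_abs, Real.norm_of_nonneg (by positivity)]
  exact div_le_div_of_nonneg_left (by positivity) hf (by nlinarith)

/-- `𝒲⁻_{λ,ν}(x) = (x/2)^ν W_{λ,ν+1}(-(x/2)^{λ+1})`, for `x > 0`. -/
noncomputable def wrightMinus (lam nu x : ℝ) : ℝ :=
  (x / 2) ^ nu * wright lam (nu + 1) (-(x / 2) ^ (lam + 1))

/-- The phase function `h(u) = (e^u - e^{-λu})/2 - a u`. -/
noncomputable def phase (lam a : ℝ) (u : ℂ) : ℂ :=
  (Complex.exp u - Complex.exp (-(lam : ℂ) * u)) / 2 - (a : ℂ) * u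

/-- A saddle point of the phase: a zero of `h'`. -/
def IsSaddle (lam a : ℝ) (u : ℂ) : Prop :=
  deriv (phase lam a) u = 0

/-- `u₀` is the upper member of the complex-conjugate pair of saddles of the strip `|Im u| ≤ π`
that lies nearest to the real axis: it is a saddle with `0 < Im u₀ ≤ π`, and no saddle of the strip
(in particular no real one) is closer to the real axis. -/
structure IsUpperSaddle (lam a : ℝ) (u₀ : ℂ) : Prop where
  saddle : IsSaddle lam a u₀
  im_pos : 0 < u₀.im
  im_le : u₀.im ≤ Real.pi
  nearest : ∀ v : ℂ, IsSaddle lam a v → |v.im| ≤ Real.pi → u₀.im ≤ |v.im|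

/-- `h₀'' = h''(u₀)`. -/
noncomputable def phaseSecond (lam a : ℝ) (u₀ : ℂ) : ℂ :=
  iteratedDeriv 2 (phase lam a) u₀

/-- `u = φ(w)` is the local inversion at `w = 0` of the change of variable
`-w²/2 = h(u) - h(u₀)`, with `u - u₀ = w / √(-h₀'') + O(w²)`. -/
structure IsSaddleInversion (lam a : ℝ) (u₀ : ℂ) (φ : ℂ → ℂ) : Prop where
  analytic : AnalyticAt ℂ φ 0
  map_zero : φ 0 = u₀
  deriv_zero : deriv φ 0 = 1 / Complex.sqrt (-phaseSecond lam a u₀)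
  phase_eq : ∀ᶠ w in 𝓝 (0 : ℂ), -(w ^ 2 / 2) = phase lam a (φ w) - phase lam a u₀

/-- The coefficient `A_k`, where the even part of the Taylor series of `du/dw` at `w = 0` is
`(1 / √(-h₀'')) ∑ (-1)^k A_k w^{2k}`. -/
noncomputable def saddleCoeff (lam a : ℝ) (u₀ : ℂ) (φ : ℂ → ℂ) (k : ℕ) : ℂ :=
  (-1) ^ k * Complex.sqrt (-phaseSecond lam a u₀) *
    (iteratedDeriv (2 * k) (deriv φ) 0 / ((2 * k).factorial : ℂ))

/-- The first `N` terms of the series `∑ (-1)^k (1/2)_k A_k (x/2)^{-k}`. -/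
noncomputable def saddlePartialSum (A : ℕ → ℂ) (N : ℕ) (x : ℝ) : ℂ :=
  ∑ k ∈ Finset.range N,
    (-1) ^ k * (ascPochhammer ℂ k).eval (1 / 2) * A k / ((x : ℂ) / 2) ^ k

/-! The substitution t = e^u in Hankel's loop integral for 1/Γ gives, after termwise summation,
𝒲⁻(x) as a contour integral of e^{x h(u)} from ∞ − iπ to ∞ + iπ. The integrand commutes with
conjugation, so only the upper half of the contour is kept: 𝒲⁻ = (1/π) Im of the integral over a
path from the real axis to ∞ + iπ. Real-axis pieces are real, so the starting point may slide
freely. This explains why imaginary parts appear throughout and why the final formula has a real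
part: √h₀'' = i√(−h₀'').

The decisive fact is that Im h'' > 0 wherever 0 < Im u < π and λ Im u < π (`phaseDeriv2_im_pos`). It
is used three times. (1) The locus Im h' = 0 is a graph over q = Im u, and h' is real and strictly
decreasing along it. It starts positive at the real axis (below the double-saddle curve, by weighted
AM-GM) and equals −a at q = π/(1+λ). Hence exactly one saddle lies below that height, and it is the
nearest one. (2) In the direction 1 + i, whose square is 2i, the second derivative of Re h is −2 Im
h'' < 0. So the straight diagonal through u₀ is a path on which Re h has its strict maximum at u₀;
no true steepest-descent curve is needed. The diagonal is completed by a vertical segment and a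
horizontal ray (`exists_descent_path`). (3) h₀'' ≠ 0, and √(−h₀'') lies in the open fourth quadrant,
which fixes all branches and orientations.

Away from u₀ everything is exponentially small relative to e^{x h(u₀)}. Near u₀ the variable w turns
the integral into a Gaussian one, to which Watson's lemma (`watson_gaussian`) applies; odd Taylor
coefficients integrate to zero. -/

/-! ### Primitives and half-loop contours -/

/-- The integral of `f` along the vertical segment from `P` to `P + iπ` followed by the horizontal
ray from `P + iπ` to `∞ + iπ`. -/
noncomputable def keyhole (f : ℂ → ℂ) (P : ℝ) : ℂ :=
  Complex.I * (∫ q in (0 : ℝ)..Real.pi, f (P + q * Complex.I)) +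
    ∫ p in Set.Ioi P, f (p + Real.pi * Complex.I)

theorem hasDerivAt_comp_line {F f : ℂ → ℂ} (hF : ∀ z, HasDerivAt F (f z) z) (z d : ℂ) (t : ℝ) :
    HasDerivAt (fun t : ℝ => F (z + t * d)) (f (z + t * d) * d) t := by
  have h1 : HasDerivAt (fun t : ℝ => z + (t : ℂ) * d) d t := by
    simpa using ((Complex.ofRealCLM.hasDerivAt (x := t)).mul_const d).const_add z
  exact (hF _).comp t h1

theorem integral_line_eq_sub {F f : ℂ → ℂ} (hF : ∀ z, HasDerivAt F (f z) z) (hf : Continuous f)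
    (z d : ℂ) (a b : ℝ) :
    ∫ t in a..b, f (z + t * d) * d = F (z + b * d) - F (z + a * d) :=
  intervalIntegral.integral_eq_sub_of_hasDerivAt
    (fun t _ => hasDerivAt_comp_line hF z d t)
    (Continuous.intervalIntegrable (by fun_prop) _ _)

theorem exists_primitive {f : ℂ → ℂ} (hf : Differentiable ℂ f) :
    ∃ F : ℂ → ℂ, ∀ z, HasDerivAt F (f z) z := by
  obtain ⟨F, hF⟩ := hf.isExactOn_univ
  exact ⟨F, fun z => hF z (Set.mem_univ z)⟩

theorem tendsto_primitive_ray {F f : ℂ → ℂ} (hF : ∀ z, HasDerivAt F (f z) z) (hf : Continuous f)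
    {P : ℝ} {c : ℂ} (hint : MeasureTheory.IntegrableOn (fun p : ℝ => f (p + c)) (Set.Ioi P)) :
    Tendsto (fun p : ℝ => F (p + c)) atTop (𝓝 (F (P + c) + ∫ p in Set.Ioi P, f (p + c))) := by
  have h := MeasureTheory.intervalIntegral_tendsto_integral_Ioi P hint tendsto_id
  refine (h.const_add (F (P + c))).congr fun p => ?_
  have := integral_line_eq_sub hF hf c 1 P p
  simp only [mul_one] at this
  simp only [id, add_comm _ c, this]
  ring

/-- Contour deformation for unbounded paths reduces to this: every path ending at ∞ + iπ computes
the same limit of a global primitive, so two contours are compared by uniqueness of limits. -/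
theorem tendsto_primitive_keyhole {F f : ℂ → ℂ} (hF : ∀ z, HasDerivAt F (f z) z)
    (hf : Continuous f) {P : ℝ}
    (hint : MeasureTheory.IntegrableOn (fun p : ℝ => f (p + Real.pi * Complex.I)) (Set.Ioi P)) :
    Tendsto (fun p : ℝ => F (p + Real.pi * Complex.I)) atTop (𝓝 (F P + keyhole f P)) := by
  have h := tendsto_primitive_ray hF hf hint
  have h2 := integral_line_eq_sub hF hf P Complex.I 0 Real.pi
  rw [intervalIntegral.integral_mul_const] at h2
  convert h using 2
  rw [keyhole, mul_comm, h2]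
  simp; ring

theorem im_primitive_ofReal_eq {F f : ℂ → ℂ} (hF : ∀ z, HasDerivAt F (f z) z)
    (hf : Continuous f) (hreal : ∀ p : ℝ, (f p).im = 0) (P Q : ℝ) : (F P).im = (F Q).im := by
  have h := integral_line_eq_sub hF hf 0 1 P Q
  simp only [mul_one, zero_add] at h
  have h2 : ∀ p : ℝ, f p = ((f p).re : ℂ) := fun p => Complex.ext (by simp) (by simp [hreal])
  have h3 : ∫ t in P..Q, f t = ((∫ t in P..Q, (f t).re : ℝ) : ℂ) := by
    rw [← intervalIntegral.integral_ofReal]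
    exact intervalIntegral.integral_congr fun t _ => h2 t
  rw [h3] at h
  have := congrArg Complex.im h
  simp at this
  linarith

/-- Sliding the foot of the contour adds an integral over a real interval, where `f` is real. -/
theorem keyhole_im_eq {f : ℂ → ℂ} (hf : Differentiable ℂ f) (hreal : ∀ p : ℝ, (f p).im = 0)
    (hint : ∀ P : ℝ, MeasureTheory.IntegrableOn
      (fun p : ℝ => f (p + Real.pi * Complex.I)) (Set.Ioi P)) (P Q : ℝ) :
    (keyhole f P).im = (keyhole f Q).im := by
  obtain ⟨F, hF⟩ := exists_primitive hf
  have h := tendsto_nhds_unique (tendsto_primitive_keyhole hF hf.continuous (hint P))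
    (tendsto_primitive_keyhole hF hf.continuous (hint Q))
  have h2 := congrArg Complex.im h
  have h3 := im_primitive_ofReal_eq hF hf.continuous hreal P Q
  simp only [Complex.add_im] at h2
  linarith

theorem keyhole_comp_add (f : ℂ → ℂ) (L P : ℝ) :
    keyhole (fun u => f (u + L)) P = keyhole f (P + L) := by
  unfold keyhole
  congr 1
  · congr 2
    ext q
    push_cast; ring_nf
  · have h := (MeasureTheory.measurePreserving_add_right MeasureTheory.volume
      L).setIntegral_image_emb (measurableEmbedding_addRight L) (fun p : ℝ => f (p + Real.pi * Complex.I)) (Set.Ioi P)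
    rw [Set.image_add_const_Ioi] at h
    rw [h]
    congr 1
    ext q
    push_cast; ring_nf

theorem integrableOn_Ioi_of_le_exp {g : ℝ → ℂ} (hg : Continuous g) {P C b : ℝ} (hb : 0 < b)
    (h : ∀ p, P < p → ‖g p‖ ≤ C * Real.exp (-b * p)) :
    MeasureTheory.IntegrableOn g (Set.Ioi P) := by
  refine MeasureTheory.Integrable.mono' ((exp_neg_integrableOn_Ioi P hb).const_mul C)
    hg.aestronglyMeasurable ?_
  filter_upwards [MeasureTheory.ae_restrict_mem measurableSet_Ioi] with p hp using h p hp

/-! ### Hankel's integral for the reciprocal Gamma function -/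

/-- The integrand of Hankel's integral for `1 / Γ(s)` after the substitution `t = e^u`. -/
noncomputable def hankelFun (s : ℝ) (u : ℂ) : ℂ := Complex.exp (Complex.exp u - (s - 1) * u)

theorem differentiable_hankelFun (s : ℝ) : Differentiable ℂ (hankelFun s) := by
  unfold hankelFun; fun_prop

theorem exp_add_pi_mul_I (p : ℝ) : Complex.exp (p + Real.pi * Complex.I) = -Real.exp p := by
  rw [Complex.exp_add, Complex.exp_pi_mul_I]; simp

theorem norm_hankelFun_ray (s p : ℝ) :
    ‖hankelFun s (p + Real.pi * Complex.I)‖ = Real.exp (-Real.exp p - (s - 1) * p) := by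
  rw [hankelFun, Complex.norm_exp, exp_add_pi_mul_I, ← Complex.ofReal_neg]
  simp [-Complex.ofReal_exp]

theorem im_hankelFun_ray (s p : ℝ) :
    (hankelFun s (p + Real.pi * Complex.I)).im =
      Real.exp (-Real.exp p - (s - 1) * p) * Real.sin ((1 - s) * Real.pi) := by
  rw [hankelFun, Complex.exp_im, exp_add_pi_mul_I, ← Complex.ofReal_neg]
  have h : -((s - 1) * Real.pi) = (1 - s) * Real.pi := by ring
  simp [-Complex.ofReal_exp, ← h]

theorem im_hankelFun_real (s p : ℝ) : (hankelFun s p).im = 0 := by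
  have : hankelFun s p = (Real.exp (Real.exp p - (s - 1) * p) : ℝ) := by
    simp [hankelFun]
  rw [this, Complex.ofReal_im]

theorem integrableOn_hankelFun_ray {s : ℝ} (hs : 0 < s) (P : ℝ) :
    MeasureTheory.IntegrableOn (fun p : ℝ => hankelFun s (p + Real.pi * Complex.I))
      (Set.Ioi P) := by
  refine integrableOn_Ioi_of_le_exp (C := 1) (b := s) ?_ hs fun p _ => ?_
  · exact (differentiable_hankelFun s).continuous.comp (by fun_prop)
  · rw [norm_hankelFun_ray, one_mul, Real.exp_le_exp]
    nlinarith [Real.add_one_le_exp p]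

theorem keyhole_hankelFun_im (s : ℝ) (hs : 0 < s) (P : ℝ) :
    (keyhole (hankelFun s) P).im =
      (∫ q in (0 : ℝ)..Real.pi, hankelFun s (P + q * Complex.I)).re +
      (∫ p in Set.Ioi P, Real.exp (-Real.exp p - (s - 1) * p)) * Real.sin ((1 - s) * Real.pi) := by
  rw [keyhole, Complex.add_im, Complex.I_mul_im, ← MeasureTheory.integral_mul_const]
  congr 1
  rw [← Complex.imCLM_apply, ← ContinuousLinearMap.integral_comp_comm _
    (integrableOn_hankelFun_ray hs P)]
  simp only [Complex.imCLM_apply, im_hankelFun_ray]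

theorem integral_exp_neg_exp {b : ℝ} (hb : 0 < b) :
    MeasureTheory.Integrable (fun p : ℝ => Real.exp (-Real.exp p + b * p)) ∧
    ∫ p : ℝ, Real.exp (-Real.exp p + b * p) = Real.Gamma b := by
  have himg : Real.exp '' Set.univ = Set.Ioi 0 := by
    rw [Set.image_univ, Real.range_exp]
  have hd : ∀ x ∈ (Set.univ : Set ℝ), HasDerivWithinAt Real.exp (Real.exp x) Set.univ x :=
    fun x _ => (Real.hasDerivAt_exp x).hasDerivWithinAt
  have hfun : ∀ p : ℝ, |Real.exp p| • (Real.exp (-Real.exp p) * Real.exp p ^ (b - 1)) =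
      Real.exp (-Real.exp p + b * p) := by
    intro p
    rw [abs_of_pos (Real.exp_pos p), smul_eq_mul, ← Real.exp_mul, ← Real.exp_add, ← Real.exp_add]
    ring_nf
  constructor
  · have h := (MeasureTheory.integrableOn_image_iff_integrableOn_abs_deriv_smul
      MeasurableSet.univ hd Real.exp_injective.injOn
      (fun t => Real.exp (-t) * t ^ (b - 1))).1 (by
        rw [himg]; exact Real.GammaIntegral_convergent hb)
    rw [MeasureTheory.integrableOn_univ] at h
    simpa only [hfun] using h
  · have h := MeasureTheory.integral_image_eq_integral_abs_deriv_smul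
      MeasurableSet.univ hd Real.exp_injective.injOn
      (fun t => Real.exp (-t) * t ^ (b - 1))
    rw [himg, MeasureTheory.Measure.restrict_univ] at h
    rw [Real.Gamma_eq_integral hb, h]
    simp only [hfun]

theorem norm_hankelFun_le (s P q : ℝ) :
    ‖hankelFun s (P + q * Complex.I)‖ ≤ Real.exp (Real.exp P + (1 - s) * P) := by
  rw [hankelFun, Complex.norm_exp, Real.exp_le_exp]
  have h1 : (Complex.exp (P + q * Complex.I)).re = Real.exp P * Real.cos q := by
    rw [Complex.exp_re]; simp
  rw [Complex.sub_re, h1]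
  simp only [Complex.mul_re, Complex.sub_re, Complex.ofReal_re, Complex.one_re, Complex.sub_im,
    Complex.ofReal_im, Complex.one_im, Complex.add_re, Complex.I_re, Complex.I_im]
  nlinarith [Real.exp_pos P, Real.cos_le_one q]

/-- Since the foot `P` is immaterial, let it tend to −∞. For `s < 1` the vertical piece dies, the
ray tends to Γ(1 − s) sin(π(1 − s)), and the reflection formula finishes. -/
theorem hankel_of_lt_one {s : ℝ} (hs : 0 < s) (hs1 : s < 1) (P : ℝ) :
    (keyhole (hankelFun s) P).im = Real.pi / Real.Gamma s := by
  have hconst : ∀ Q, (keyhole (hankelFun s) Q).im = (keyhole (hankelFun s) P).im := fun Q =>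
    keyhole_im_eq (differentiable_hankelFun s) (im_hankelFun_real s)
      (integrableOn_hankelFun_ray hs) Q P
  have hb : 0 < 1 - s := by linarith
  obtain ⟨hi, hI⟩ := integral_exp_neg_exp hb
  have hfun : ∀ p : ℝ, -Real.exp p - (s - 1) * p = -Real.exp p + (1 - s) * p := fun p => by ring
  have h2 : Tendsto (fun Q : ℝ => ∫ p in Set.Ioi Q, Real.exp (-Real.exp p - (s - 1) * p)) atBot
      (𝓝 (Real.Gamma (1 - s))) := by
    rw [← hI]
    simp only [hfun]
    exact (MeasureTheory.aecover_Ioi tendsto_id).integral_tendsto_of_countably_generated hi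
  have h1 : Tendsto (fun Q : ℝ => (∫ q in (0 : ℝ)..Real.pi, hankelFun s (Q + q * Complex.I)).re)
      atBot (𝓝 0) := by
    have hz : Tendsto (fun Q : ℝ => Real.exp (Real.exp Q + (1 - s) * Q) * |Real.pi - 0|) atBot
        (𝓝 0) := by
      have h3 : Tendsto (fun Q : ℝ => Real.exp Q + (1 - s) * Q) atBot atBot :=
        Real.tendsto_exp_atBot.add_atBot (tendsto_id.const_mul_atBot hb)
      simpa using (Real.tendsto_exp_atBot.comp h3).mul_const |Real.pi - 0|
    refine squeeze_zero_norm (fun Q => ?_) hz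
    refine (Complex.abs_re_le_norm _).trans ?_
    exact intervalIntegral.norm_integral_le_of_norm_le_const fun q _ => norm_hankelFun_le s Q q
  have h := h1.add (h2.mul_const (Real.sin ((1 - s) * Real.pi)))
  simp only [← keyhole_hankelFun_im s hs, hconst, zero_add] at h
  rw [tendsto_nhds_unique tendsto_const_nhds h]
  have hG := Real.Gamma_mul_Gamma_one_sub s
  have hsin : Real.sin ((1 - s) * Real.pi) = Real.sin (Real.pi * s) := by
    rw [← Real.sin_pi_sub]; ring_nf
  have hpos : 0 < Real.sin (Real.pi * s) :=
    Real.sin_pos_of_pos_of_lt_pi (by positivity) (by nlinarith [Real.pi_pos])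
  have := (Real.Gamma_pos_of_pos hs).ne'
  rw [hsin, mul_comm]
  rw [eq_div_iff hpos.ne'] at hG
  rw [eq_div_iff this]
  linarith

/-- At `s = 1` the sine factor removes the ray, while the integrand on the vertical segment tends to
1 as the foot goes to −∞, leaving the segment's length π. -/
theorem hankel_one (P : ℝ) : (keyhole (hankelFun 1) P).im = Real.pi := by
  have hconst : ∀ Q, (keyhole (hankelFun 1) Q).im = (keyhole (hankelFun 1) P).im := fun Q =>
    keyhole_im_eq (differentiable_hankelFun 1) (im_hankelFun_real 1)
      (integrableOn_hankelFun_ray one_pos) Q P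
  have hval : ∀ Q, (keyhole (hankelFun 1) Q).im =
      (∫ q in (0 : ℝ)..Real.pi, hankelFun 1 (Q + q * Complex.I)).re := fun Q => by
    rw [keyhole_hankelFun_im 1 one_pos]; simp
  have h1 : Tendsto (fun Q : ℝ => ∫ q in (0 : ℝ)..Real.pi, hankelFun 1 (Q + q * Complex.I))
      atBot (𝓝 (∫ q in (0 : ℝ)..Real.pi, (1 : ℂ))) := by
    refine intervalIntegral.tendsto_integral_filter_of_dominated_convergence
      (fun _ => Real.exp 1) ?_ ?_ (by simp) ?_
    · exact Eventually.of_forall fun Q =>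
        ((differentiable_hankelFun 1).continuous.comp (by fun_prop)).aestronglyMeasurable
    · filter_upwards [Filter.eventually_le_atBot 0] with Q hQ
      refine Eventually.of_forall fun q _ => (norm_hankelFun_le 1 Q q).trans ?_
      rw [Real.exp_le_exp]
      simpa using Real.exp_le_exp.2 hQ
    · refine Eventually.of_forall fun q _ => ?_
      have h2 : Tendsto (fun Q : ℝ => Complex.exp (Q + q * Complex.I)) atBot (𝓝 0) := by
        refine tendsto_zero_iff_norm_tendsto_zero.2 ?_
        simpa [Complex.norm_exp] using Real.tendsto_exp_atBot
      have h3 := (Complex.continuous_exp.tendsto 0).comp h2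
      simpa [hankelFun, Function.comp_def] using h3
  have h := (Complex.continuous_re.tendsto _).comp h1
  simp only [Function.comp_def, ← hval, hconst] at h
  rw [tendsto_nhds_unique tendsto_const_nhds h]
  simp

/-- Integration by parts: the derivative of `hankelFun (s + 1)` is `hankelFun s - s * hankelFun (s +
1)`. The boundary term is real at the foot and vanishes at ∞ + iπ. -/
theorem hankel_add_one {s : ℝ} (hs : 0 < s) (P : ℝ) :
    (keyhole (hankelFun s) P).im = s * (keyhole (hankelFun (s + 1)) P).im := by
  obtain ⟨F, hF⟩ := exists_primitive (differentiable_hankelFun (s + 1))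
  have hG : ∀ z, HasDerivAt (fun z => hankelFun (s + 1) z + s * F z) (hankelFun s z) z := by
    intro z
    have h1 : HasDerivAt (fun z : ℂ => Complex.exp z - ((s + 1 : ℝ) - 1) * z)
        (Complex.exp z - ((s + 1 : ℝ) - 1) * 1) z :=
      (Complex.hasDerivAt_exp z).sub ((hasDerivAt_id z).const_mul _)
    have h2 := h1.cexp.add ((hF z).const_mul (s : ℂ))
    refine h2.congr_deriv ?_
    have h3 : hankelFun s z = Complex.exp (Complex.exp z - ((s + 1 : ℝ) - 1) * z) *
        Complex.exp z := by
      rw [hankelFun, ← Complex.exp_add]; push_cast; ring_nf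
    rw [h3, hankelFun]
    push_cast; ring
  have hT1 := tendsto_primitive_keyhole hF (differentiable_hankelFun _).continuous
    (integrableOn_hankelFun_ray (by linarith : 0 < s + 1) P)
  have hT2 := tendsto_primitive_keyhole hG (differentiable_hankelFun _).continuous
    (integrableOn_hankelFun_ray hs P)
  have hT3 : Tendsto (fun p : ℝ => hankelFun (s + 1) (p + Real.pi * Complex.I)) atTop (𝓝 0) := by
    refine tendsto_zero_iff_norm_tendsto_zero.2 ?_
    simp only [norm_hankelFun_ray]
    refine Real.tendsto_exp_atBot.comp ?_
    refine tendsto_atBot_mono' _ ?_ tendsto_neg_atTop_atBot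
    filter_upwards [eventually_ge_atTop 0] with p hp
    nlinarith [Real.add_one_le_exp p, mul_nonneg hs.le hp]
  have hT4 := hT3.add (hT1.const_mul (s : ℂ))
  have h := congrArg Complex.im (tendsto_nhds_unique hT2 hT4)
  simp only [Complex.add_im, im_hankelFun_real, Complex.zero_im, Complex.im_ofReal_mul] at h
  linarith

/-- Hankel's integral for the reciprocal Gamma function. -/
theorem hankel {s : ℝ} (hs : 0 < s) (P : ℝ) :
    (keyhole (hankelFun s) P).im = Real.pi / Real.Gamma s := by
  have hle : ∀ s : ℝ, 0 < s → s ≤ 1 →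
      (keyhole (hankelFun s) P).im = Real.pi / Real.Gamma s := by
    intro s hs h
    rcases h.lt_or_eq with h | rfl
    · exact hankel_of_lt_one hs h P
    · rw [hankel_one, Real.Gamma_one, div_one]
  -- The recurrence extends the formula from (0, 1] one unit at a time.
  have key : ∀ n : ℕ, ∀ s : ℝ, 0 < s → s ≤ n + 1 →
      (keyhole (hankelFun s) P).im = Real.pi / Real.Gamma s := by
    intro n
    induction n with
    | zero => exact fun s hs h1 => hle s hs (by simpa using h1)
    | succ n ih =>
      intro s hs h1
      rcases le_or_gt s 1 with h | h
      · exact hle s hs h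
      · have h0 : 0 < s - 1 := by linarith
        have h2 := ih (s - 1) h0 (by push_cast at h1; linarith)
        have h3 := hankel_add_one h0 P
        have h4 := Real.Gamma_add_one h0.ne'
        rw [sub_add_cancel] at h3 h4
        have h5 := (Real.Gamma_pos_of_pos h0).ne'
        rw [h2] at h3
        rw [h4]
        field_simp at h3 ⊢
        linarith
  obtain ⟨n, hn⟩ := exists_nat_ge s
  exact key n s hs (by linarith)

/-! ### The contour integral for 𝒲⁻ -/

theorem keyhole_real_mul (c : ℝ) (f : ℂ → ℂ) (P : ℝ) :
    keyhole (fun u => c * f u) P = c * keyhole f P := by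
  simp only [keyhole, intervalIntegral.integral_const_mul, MeasureTheory.integral_const_mul]
  ring

theorem hasSum_keyhole {g : ℕ → ℂ → ℂ} {G S : ℂ → ℂ} {c : ℕ → ℝ} {P : ℝ} (hc : Summable c)
    (hg : ∀ n, Continuous (g n)) (hG : Continuous G)
    (hint : MeasureTheory.IntegrableOn (fun p : ℝ => G (p + Real.pi * Complex.I)) (Set.Ioi P))
    (hbound : ∀ n u, P ≤ u.re → ‖g n u‖ ≤ c n * ‖G u‖)
    (hsum : ∀ u, P ≤ u.re → HasSum (fun n => g n u) (S u)) :
    HasSum (fun n => keyhole (g n) P) (keyhole S P) := by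
  refine HasSum.add (HasSum.mul_left _ ?_) ?_
  · refine intervalIntegral.hasSum_integral_of_dominated_convergence
      (fun n q => c n * ‖G (P + q * Complex.I)‖) (fun n => ?_) (fun n => ?_) ?_ ?_ ?_
    · exact ((hg n).comp (by fun_prop)).aestronglyMeasurable
    · exact Eventually.of_forall fun q _ => hbound n _ (by simp)
    · exact Eventually.of_forall fun q _ => hc.mul_right _
    · simp only [tsum_mul_right]
      exact Continuous.intervalIntegrable (by fun_prop) _ _
    · exact Eventually.of_forall fun q _ => hsum _ (by simp)
  · have hmem := MeasureTheory.ae_restrict_mem (μ := MeasureTheory.volume)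
      (measurableSet_Ioi (a := P))
    refine MeasureTheory.hasSum_integral_of_dominated_convergence
      (fun n p => c n * ‖G (p + Real.pi * Complex.I)‖) (fun n => ?_) (fun n => ?_) ?_ ?_ ?_
    · exact ((hg n).comp (by fun_prop)).aestronglyMeasurable
    · filter_upwards [hmem] with p hp
      exact hbound n _ (by simpa using (Set.mem_Ioi.1 hp).le)
    · exact Eventually.of_forall fun q => hc.mul_right _
    · simp only [tsum_mul_right]
      exact hint.norm.const_mul _
    · filter_upwards [hmem] with p hp
      exact hsum _ (by simpa using (Set.mem_Ioi.1 hp).le)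

/-- The translation u ↦ u + log y absorbs the factor `y`; it moves the foot to log y, where Hankel's
formula holds just as well. -/
theorem keyhole_exp_scaled {y b : ℝ} (hy : 0 < y) (hb : -1 < b) :
    (keyhole (fun u => Complex.exp (y * Complex.exp u - b * u)) 0).im =
      Real.pi * y ^ b / Real.Gamma (b + 1) := by
  have h1 := hankel (by linarith : 0 < b + 1) (0 + Real.log y)
  rw [← keyhole_comp_add] at h1
  have h2 : (fun u : ℂ => hankelFun (b + 1) (u + Real.log y)) =
      fun u => ((y ^ (-b) : ℝ) : ℂ) * Complex.exp (y * Complex.exp u - b * u) := by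
    ext u
    have h3 : y ^ (-b) = Real.exp (Real.log y * -b) := Real.rpow_def_of_pos hy _
    have h4 : (y : ℂ) = Complex.exp (Real.log y) := by
      rw [← Complex.ofReal_exp, Real.exp_log hy]
    rw [hankelFun, h3, Complex.ofReal_exp, ← Complex.exp_add, Complex.exp_add u, ← h4]
    push_cast
    ring_nf
  rw [h2, keyhole_real_mul, Complex.im_ofReal_mul, Real.rpow_neg hy.le] at h1
  have h5 := (Real.rpow_pos_of_pos hy b).ne'
  have h6 := (Real.Gamma_pos_of_pos (by linarith : 0 < b + 1)).ne'
  field_simp at h1 ⊢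
  linarith

theorem differentiable_phase (lam a : ℝ) : Differentiable ℂ (phase lam a) := by
  unfold phase; fun_prop

/-- The Schläfli-type integral for `𝒲⁻_{λ,ax}(x)`. -/
theorem wrightMinus_eq_keyhole {lam a x : ℝ} (hlam : 0 < lam) (ha : 0 < a) (hx : 0 < x) :
    wrightMinus lam (a * x) x =
      1 / Real.pi * (keyhole (fun u => Complex.exp (x * phase lam a u)) 0).im := by
  set y := x / 2 with hy'
  have hy : 0 < y := by positivity
  set b := a * x with hb'
  have hb : 0 < b := by positivity
  have hsum : HasSum (fun n : ℕ => keyhole (fun u => (((-y) ^ n / n.factorial : ℝ) : ℂ) *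
      Complex.exp (y * Complex.exp u - ((b + lam * n : ℝ) : ℂ) * u)) 0)
      (keyhole (fun u => Complex.exp (x * phase lam a u)) 0) := by
    -- The series is that of exp(−y e^{−λu}). Taking the foot at 0 keeps Re u ≥ 0 on the contour, so
    -- |e^{−λu}| ≤ 1 and yⁿ/n! dominates.
    have hterm : ∀ n : ℕ, ∀ u : ℂ, (((-y) ^ n / n.factorial : ℝ) : ℂ) *
        Complex.exp (y * Complex.exp u - ((b + lam * n : ℝ) : ℂ) * u) =
        (-y * Complex.exp (-(lam * u))) ^ n / n.factorial *
          Complex.exp (y * Complex.exp u - b * u) := by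
      intro n u
      rw [mul_pow, ← Complex.exp_nat_mul]
      have : (y : ℂ) * Complex.exp u - ((b + lam * n : ℝ) : ℂ) * u =
        n * (-(lam * u)) + (y * Complex.exp u - b * u) := by push_cast; ring
      rw [this, Complex.exp_add]
      push_cast; ring
    refine hasSum_keyhole (G := fun u => Complex.exp (y * Complex.exp u - b * u))
      (Real.summable_pow_div_factorial y) (fun n => by fun_prop) (by fun_prop) ?_ ?_ ?_
    · refine integrableOn_Ioi_of_le_exp (C := 1) (by fun_prop) hb fun p _ => ?_
      rw [Complex.norm_exp, exp_add_pi_mul_I, one_mul, Real.exp_le_exp]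
      have := mul_pos hy (Real.exp_pos p)
      simp [-Complex.ofReal_exp]
      linarith
    · intro n u hu
      rw [hterm, norm_mul]
      refine mul_le_mul_of_nonneg_right ?_ (norm_nonneg _)
      rw [norm_div, norm_pow, norm_mul, norm_neg, Complex.norm_real, Complex.norm_natCast,
        Real.norm_of_nonneg hy.le, Complex.norm_exp]
      have h1 : Real.exp ((-(lam * u) : ℂ).re) ≤ 1 := by
        rw [Real.exp_le_one_iff]
        simpa using mul_nonneg hlam.le hu
      gcongr
      exact mul_le_of_le_one_right hy.le h1
    · intro u _
      simp only [hterm]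
      have h1 : Complex.exp (x * phase lam a u) = Complex.exp (-y * Complex.exp (-(lam * u))) *
          Complex.exp (y * Complex.exp u - b * u) := by
        rw [← Complex.exp_add, phase, hy', hb']
        push_cast; ring_nf
      rw [h1]
      refine HasSum.mul_right _ ?_
      rw [Complex.exp_eq_exp_ℂ]
      exact NormedSpace.expSeries_div_hasSum_exp _
  have him := Complex.hasSum_im hsum
  have hval : ∀ n : ℕ, (keyhole (fun u => (((-y) ^ n / n.factorial : ℝ) : ℂ) *
      Complex.exp (y * Complex.exp u - ((b + lam * n : ℝ) : ℂ) * u)) 0).im =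
      Real.pi * (y ^ b * ((-y ^ (lam + 1)) ^ n /
        ((n.factorial : ℝ) * Real.Gamma (lam * n + (b + 1))))) := by
    intro n
    have hbn : 0 ≤ lam * n := by positivity
    rw [keyhole_real_mul, Complex.im_ofReal_mul, keyhole_exp_scaled hy (by linarith),
      Real.rpow_add hy, neg_pow (y ^ (lam + 1)), ← Real.rpow_mul_natCast hy.le, add_mul,
      Real.rpow_add hy (lam * n), one_mul, Real.rpow_natCast, neg_pow y,
      show b + lam * n + 1 = lam * n + (b + 1) by ring]
    have := (Real.Gamma_pos_of_pos (by linarith : 0 < lam * n + (b + 1))).ne'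
    field_simp
  simp only [hval] at him
  have h2 := him.tsum_eq
  rw [tsum_mul_left, tsum_mul_left] at h2
  rw [← h2, wrightMinus, wright]
  have := Real.pi_pos.ne'
  rw [← hy']
  field_simp

/-! ### Derivatives of the phase -/

theorem hasDerivAt_phase (lam a : ℝ) (u : ℂ) :
    HasDerivAt (phase lam a) ((Complex.exp u + lam * Complex.exp (-lam * u)) / 2 - a) u := by
  have h1 : HasDerivAt (fun u : ℂ => -(lam : ℂ) * u) (-(lam : ℂ) * 1) u :=
    (hasDerivAt_id u).const_mul _
  have h2 := (((Complex.hasDerivAt_exp u).sub h1.cexp).div_const 2).sub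
    ((hasDerivAt_id u).const_mul (a : ℂ))
  refine h2.congr_deriv ?_
  ring

/-- The derivative `h'`. -/
noncomputable def phaseDeriv (lam a : ℝ) (u : ℂ) : ℂ :=
  (Complex.exp u + lam * Complex.exp (-lam * u)) / 2 - a

theorem deriv_phase (lam a : ℝ) : deriv (phase lam a) = phaseDeriv lam a :=
  funext fun u => (hasDerivAt_phase lam a u).deriv

/-- The second derivative `h''`. -/
noncomputable def phaseDeriv2 (lam : ℝ) (u : ℂ) : ℂ :=
  (Complex.exp u - lam ^ 2 * Complex.exp (-lam * u)) / 2

theorem hasDerivAt_phaseDeriv (lam a : ℝ) (u : ℂ) :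
    HasDerivAt (phaseDeriv lam a) (phaseDeriv2 lam u) u := by
  have h1 : HasDerivAt (fun u : ℂ => -(lam : ℂ) * u) (-(lam : ℂ) * 1) u :=
    (hasDerivAt_id u).const_mul _
  have h2 := (((Complex.hasDerivAt_exp u).add (h1.cexp.const_mul (lam : ℂ))).div_const 2).sub_const
    (a : ℂ)
  refine h2.congr_deriv ?_
  rw [phaseDeriv2]
  ring

theorem phaseSecond_eq (lam a : ℝ) (u : ℂ) : phaseSecond lam a u = phaseDeriv2 lam u := by
  rw [phaseSecond, iteratedDeriv_succ, iteratedDeriv_one, deriv_phase]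
  exact (hasDerivAt_phaseDeriv lam a u).deriv

theorem isSaddle_iff (lam a : ℝ) (u : ℂ) : IsSaddle lam a u ↔ phaseDeriv lam a u = 0 := by
  rw [IsSaddle, deriv_phase]

theorem phase_re (lam a : ℝ) (u : ℂ) : (phase lam a u).re =
    (Real.exp u.re * Real.cos u.im - Real.exp (-lam * u.re) * Real.cos (lam * u.im)) / 2
      - a * u.re := by
  simp [phase, Complex.exp_re]

theorem phaseDeriv_re (lam a : ℝ) (u : ℂ) : (phaseDeriv lam a u).re =
    (Real.exp u.re * Real.cos u.im + lam * (Real.exp (-lam * u.re) * Real.cos (lam * u.im))) / 2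
      - a := by
  simp [phaseDeriv, Complex.exp_re]

theorem phaseDeriv_im (lam a : ℝ) (u : ℂ) : (phaseDeriv lam a u).im =
    (Real.exp u.re * Real.sin u.im - lam * (Real.exp (-lam * u.re) * Real.sin (lam * u.im))) / 2 :=
    by
  simp [phaseDeriv, Complex.exp_im]
  ring

theorem phaseDeriv2_im (lam : ℝ) (u : ℂ) : (phaseDeriv2 lam u).im =
    (Real.exp u.re * Real.sin u.im +
      lam ^ 2 * (Real.exp (-lam * u.re) * Real.sin (lam * u.im))) / 2 := by
  rw [phaseDeriv2, ← Complex.ofReal_pow]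
  simp [Complex.exp_im, -Complex.ofReal_pow]

theorem phaseDeriv2_im_pos {lam : ℝ} (hlam : 0 < lam) {u : ℂ} (h0 : 0 < u.im)
    (h1 : u.im < Real.pi) (h2 : lam * u.im < Real.pi) : 0 < (phaseDeriv2 lam u).im := by
  rw [phaseDeriv2_im]
  have := Real.sin_pos_of_pos_of_lt_pi h0 h1
  have := Real.sin_pos_of_pos_of_lt_pi (mul_pos hlam h0) h2
  positivity

theorem phaseDeriv_conj (lam a : ℝ) (u : ℂ) :
    phaseDeriv lam a (starRingEnd ℂ u) = starRingEnd ℂ (phaseDeriv lam a u) := by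
  simp [phaseDeriv, ← Complex.exp_conj, Complex.conj_ofNat]

/-! ### Location of the saddles -/

/-- Below the double-saddle curve, `h'` is positive on the real axis. -/
theorem phaseDeriv_real_pos {lam a : ℝ} (hlam : 0 < lam)
    (hbelow : a < (1 + lam) / 2 * lam ^ ((1 - lam) / (1 + lam))) (p : ℝ) :
    0 < (phaseDeriv lam a p).re := by
  rw [phaseDeriv_re]
  simp only [Complex.ofReal_re, Complex.ofReal_im, Real.cos_zero, mul_zero, mul_one]
  have hL : 0 < 1 + lam := by linarith
  -- The weights are chosen so that the powers of e^p cancel in the geometric mean, leaving the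
  -- constant of the double-saddle curve.
  have h := Real.geom_mean_le_arith_mean2_weighted (w₁ := lam / (1 + lam)) (w₂ := 1 / (1 + lam))
    (p₁ := (1 + lam) / lam * Real.exp p) (p₂ := (1 + lam) * lam * Real.exp (-lam * p))
    (by positivity) (by positivity) (by positivity) (by positivity) (by field_simp; ring)
  have e1 : lam / (1 + lam) * ((1 + lam) / lam * Real.exp p) +
      1 / (1 + lam) * ((1 + lam) * lam * Real.exp (-lam * p)) =
      Real.exp p + lam * Real.exp (-lam * p) := by field_simp
  have e2 : ((1 + lam) / lam * Real.exp p) ^ (lam / (1 + lam)) *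
      ((1 + lam) * lam * Real.exp (-lam * p)) ^ (1 / (1 + lam)) =
      (1 + lam) * lam ^ ((1 - lam) / (1 + lam)) := by
    have e3 : (1 + lam) / lam * Real.exp p = Real.exp (Real.log (1 + lam) - Real.log lam + p) := by
      rw [Real.exp_add, Real.exp_sub, Real.exp_log hL, Real.exp_log hlam]
    have e4 : (1 + lam) * lam * Real.exp (-lam * p) =
        Real.exp (Real.log (1 + lam) + Real.log lam + -lam * p) := by
      rw [Real.exp_add, Real.exp_add, Real.exp_log hL, Real.exp_log hlam]
    rw [e3, e4, ← Real.exp_mul, ← Real.exp_mul, ← Real.exp_add, Real.rpow_def_of_pos hlam]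
    nth_rewrite 5 [← Real.exp_log hL]
    rw [← Real.exp_add]
    congr 1
    field_simp
    ring
  rw [e1, e2] at h
  linarith

/-- The real part of the point with imaginary part `q` on the curve `Im h' = 0`. -/
noncomputable def saddleCurveRe (lam q : ℝ) : ℝ :=
  Real.log (lam * Real.sin (lam * q) / Real.sin q) / (1 + lam)

/-- The point with imaginary part `q` on the curve `Im h' = 0`. -/
noncomputable def saddleCurve (lam q : ℝ) : ℂ := saddleCurveRe lam q + q * Complex.I

theorem saddleCurve_re (lam q : ℝ) : (saddleCurve lam q).re = saddleCurveRe lam q := by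
  simp [saddleCurve]

theorem saddleCurve_im (lam q : ℝ) : (saddleCurve lam q).im = q := by
  simp [saddleCurve]

/-- With both sines positive, Im h' = 0 reads e^{(1+λ)p} = λ sin(λq)/sin q, which has one solution p
for each q. -/
theorem im_phaseDeriv_eq_zero_iff {lam : ℝ} (a : ℝ) (hlam : 0 < lam) {u : ℂ} (h0 : 0 < u.im)
    (h1 : u.im < Real.pi) (h2 : lam * u.im < Real.pi) :
    (phaseDeriv lam a u).im = 0 ↔ u.re = saddleCurveRe lam u.im := by
  have hs1 := Real.sin_pos_of_pos_of_lt_pi h0 h1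
  have hs2 := Real.sin_pos_of_pos_of_lt_pi (mul_pos hlam h0) h2
  have hL : 0 < 1 + lam := by linarith
  have e : Real.exp u.re = Real.exp (-lam * u.re) * Real.exp ((1 + lam) * u.re) := by
    rw [← Real.exp_add]; ring_nf
  have he := Real.exp_pos (-lam * u.re)
  rw [phaseDeriv_im, saddleCurveRe, eq_div_iff hL.ne', eq_comm (b := Real.log _),
    ← Real.exp_eq_exp (x := Real.log _), Real.exp_log (by positivity), div_eq_iff hs1.ne', e]
  constructor
  · intro h
    have : Real.exp (-lam * u.re) * (lam * Real.sin (lam * u.im) -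
      Real.exp (u.re * (1 + lam)) * Real.sin u.im) = 0 := by
      rw [mul_comm u.re]; linarith
    rcases mul_eq_zero.1 this with h | h
    · exact absurd h he.ne'
    · linarith
  · intro h
    rw [mul_comm u.re] at h
    linear_combination (-Real.exp (-lam * u.re) / 2) * h

theorem differentiableAt_saddleCurveRe {lam : ℝ} (hlam : 0 < lam) {q : ℝ} (h0 : 0 < q)
    (h1 : q < Real.pi) (h2 : lam * q < Real.pi) : DifferentiableAt ℝ (saddleCurveRe lam) q := by
  have hs1 := Real.sin_pos_of_pos_of_lt_pi h0 h1
  have hs2 := Real.sin_pos_of_pos_of_lt_pi (mul_pos hlam h0) h2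
  unfold saddleCurveRe
  refine DifferentiableAt.div_const (DifferentiableAt.log ?_ (by positivity)) _
  exact DifferentiableAt.div (by fun_prop) (by fun_prop) hs1.ne'

/-- Along the curve `Im h' = 0` the real number `h'` is strictly decreasing in `Im u`. -/
theorem saddleCurve_deriv_neg {lam : ℝ} (a : ℝ) (hlam : 0 < lam) {q : ℝ} (h0 : 0 < q)
    (h1 : q < Real.pi) (h2 : lam * q < Real.pi) :
    ∃ d < 0, HasDerivAt (fun q => (phaseDeriv lam a (saddleCurve lam q)).re) d q := by
  obtain ⟨P', hP⟩ : ∃ P', HasDerivAt (saddleCurveRe lam) P' q :=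
    ⟨_, (differentiableAt_saddleCurveRe hlam h0 h1 h2).hasDerivAt⟩
  have hc : HasDerivAt (saddleCurve lam) (P' + 1 * Complex.I) q :=
    hP.ofReal_comp.add (((hasDerivAt_id q).ofReal_comp).mul_const Complex.I)
  have hG : HasDerivAt (fun q => phaseDeriv lam a (saddleCurve lam q))
      (phaseDeriv2 lam (saddleCurve lam q) * (P' + 1 * Complex.I)) q :=
    (hasDerivAt_phaseDeriv lam a (saddleCurve lam q)).comp q hc
  have hre : HasDerivAt (fun q => (phaseDeriv lam a (saddleCurve lam q)).re)
      (phaseDeriv2 lam (saddleCurve lam q) * (P' + 1 * Complex.I)).re q :=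
    Complex.reCLM.hasFDerivAt.comp_hasDerivAt q hG
  have him : HasDerivAt (fun q => (phaseDeriv lam a (saddleCurve lam q)).im)
      (phaseDeriv2 lam (saddleCurve lam q) * (P' + 1 * Complex.I)).im q :=
    Complex.imCLM.hasFDerivAt.comp_hasDerivAt q hG
  -- With h'' = X + iY, constancy of Im h' along the curve gives X + Y P' = 0. The derivative of Re
  -- h' is X P' − Y, and Y times it is −X² − Y² < 0.
  have hzero : (fun q => (phaseDeriv lam a (saddleCurve lam q)).im) =ᶠ[𝓝 q] fun _ => 0 := by
    have hc2 : ContinuousAt (fun q : ℝ => lam * q) q := by fun_prop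
    filter_upwards [lt_mem_nhds h0, gt_mem_nhds h1, hc2.eventually_lt_const h2] with r r0 r1 r2
    rw [im_phaseDeriv_eq_zero_iff a hlam] <;> simp [saddleCurve_im, saddleCurve_re, *]
  have h3 := him.unique ((hasDerivAt_const q (0 : ℝ)).congr_of_eventuallyEq hzero)
  refine ⟨_, ?_, hre⟩
  have hpos : 0 < (phaseDeriv2 lam (saddleCurve lam q)).im :=
    phaseDeriv2_im_pos hlam (by rwa [saddleCurve_im]) (by rwa [saddleCurve_im])
      (by rwa [saddleCurve_im])
  simp only [Complex.mul_re, Complex.mul_im, Complex.add_re, Complex.add_im, Complex.ofReal_re,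
    Complex.ofReal_im, Complex.I_re, Complex.I_im, Complex.one_re, Complex.one_im] at h3 ⊢
  set X := (phaseDeriv2 lam (saddleCurve lam q)).re
  set Y := (phaseDeriv2 lam (saddleCurve lam q)).im
  have h4 : Y * P' = -X := by linarith
  by_contra hcon
  push Not at hcon
  have h5 : 0 ≤ Y * (X * P' - Y) := mul_nonneg hpos.le (by linarith)
  have h6 : Y * (X * P' - Y) = -X ^ 2 - Y ^ 2 := by linear_combination X * h4
  nlinarith [mul_pos hpos hpos, sq_nonneg X]

theorem lt_pi_of_le_pi_div {lam q : ℝ} (hlam : 0 < lam) (h : q ≤ Real.pi / (1 + lam)) :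
    q < Real.pi ∧ lam * q < Real.pi := by
  have hL : 0 < 1 + lam := by linarith
  rw [le_div_iff₀ hL] at h
  constructor <;> by_contra hcon <;> push Not at hcon <;> nlinarith [Real.pi_pos]

theorem strictAntiOn_saddleCurve {lam : ℝ} (a : ℝ) (hlam : 0 < lam) :
    StrictAntiOn (fun q => (phaseDeriv lam a (saddleCurve lam q)).re)
      (Set.Ioc 0 (Real.pi / (1 + lam))) := by
  have hd : ∀ q ∈ Set.Ioc 0 (Real.pi / (1 + lam)), ∃ d < 0, HasDerivAt
      (fun q => (phaseDeriv lam a (saddleCurve lam q)).re) d q := fun q hq =>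
    saddleCurve_deriv_neg a hlam hq.1 (lt_pi_of_le_pi_div hlam hq.2).1 (lt_pi_of_le_pi_div hlam hq.2).2
  refine strictAntiOn_of_deriv_neg (convex_Ioc _ _) (fun q hq => ?_) fun q hq => ?_
  · obtain ⟨d, _, h⟩ := hd q hq
    exact h.continuousAt.continuousWithinAt
  · obtain ⟨d, h0, h⟩ := hd q (interior_subset hq)
    rwa [h.deriv]

/-- At this height λq = π − q: the sines agree and the cosines are opposite, so Im h' = 0 makes the
exponential terms of Re h' cancel. -/
theorem phaseDeriv_saddleCurve_end {lam : ℝ} (a : ℝ) (hlam : 0 < lam) :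
    (phaseDeriv lam a (saddleCurve lam (Real.pi / (1 + lam)))).re = -a := by
  have hL : 0 < 1 + lam := by linarith
  set q := Real.pi / (1 + lam) with hq
  have h0 : 0 < q := by have := Real.pi_pos; positivity
  obtain ⟨h1, h2⟩ := lt_pi_of_le_pi_div hlam hq.le
  have him := (im_phaseDeriv_eq_zero_iff a hlam (u := saddleCurve lam q) (by rwa [saddleCurve_im])
    (by rwa [saddleCurve_im]) (by rwa [saddleCurve_im])).2 (by rw [saddleCurve_re, saddleCurve_im])
  have hlq : lam * q = Real.pi - q := by rw [hq]; field_simp; ring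
  have hs1 := Real.sin_pos_of_pos_of_lt_pi h0 h1
  rw [phaseDeriv_im, saddleCurve_im, hlq, Real.sin_pi_sub] at him
  rw [phaseDeriv_re, saddleCurve_im, hlq, Real.cos_pi_sub]
  have : Real.exp (saddleCurve lam q).re = lam * Real.exp (-lam * (saddleCurve lam q).re) := by
    apply mul_right_cancel₀ hs1.ne'
    linarith
  rw [this]; ring

/-- The sine quotient tends to λ as q → 0, so the curve lands on the real axis, where the sign of h'
is known. -/
theorem tendsto_saddleCurve_zero {lam : ℝ} (hlam : 0 < lam) :
    ∃ p : ℝ, Tendsto (saddleCurve lam) (𝓝[>] 0) (𝓝 p) := by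
  have hs : ∀ c : ℝ, Tendsto (fun q : ℝ => Real.sin (c * q) / q) (𝓝[>] 0) (𝓝 c) := by
    intro c
    have h : HasDerivAt (fun q : ℝ => Real.sin (c * q)) c 0 := by
      have h1 : HasDerivAt (fun q : ℝ => c * q) (c * 1) 0 := (hasDerivAt_id _).const_mul c
      simpa using h1.sin
    have h2 := h.tendsto_slope.mono_left (nhdsGT_le_nhdsNE 0)
    simpa [slope_fun_def, div_eq_inv_mul] using h2
  have h1 : Tendsto (fun q : ℝ => lam * Real.sin (lam * q) / Real.sin q) (𝓝[>] 0)
      (𝓝 (lam * lam / 1)) := by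
    have h2 := ((hs lam).const_mul lam).div (hs 1) one_ne_zero
    refine h2.congr' ?_
    filter_upwards [self_mem_nhdsWithin] with q hq
    have : q ≠ 0 := (Set.mem_Ioi.1 hq).ne'
    simp only [Pi.div_apply, one_mul]
    field_simp
  have h3 : Tendsto (saddleCurveRe lam) (𝓝[>] 0) (𝓝 (Real.log (lam * lam / 1) / (1 + lam))) :=
    (h1.log (by positivity)).div_const _
  refine ⟨Real.log (lam * lam / 1) / (1 + lam), ?_⟩
  have h4 : Tendsto (fun q : ℝ => (q : ℂ) * Complex.I) (𝓝[>] 0) (𝓝 0) := by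
    have : Continuous fun q : ℝ => (q : ℂ) * Complex.I := by fun_prop
    simpa using (this.tendsto 0).mono_left nhdsWithin_le_nhds
  have h5 := ((Complex.continuous_ofReal.tendsto _).comp h3).add h4
  rw [add_zero] at h5
  exact h5

theorem isSaddle_iff_saddleCurve {lam : ℝ} (a : ℝ) (hlam : 0 < lam) {u : ℂ} (h0 : 0 < u.im)
    (h : u.im < Real.pi / (1 + lam)) : IsSaddle lam a u ↔
      u = saddleCurve lam u.im ∧ (phaseDeriv lam a (saddleCurve lam u.im)).re = 0 := by
  obtain ⟨h1, h2⟩ := lt_pi_of_le_pi_div hlam h.le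
  have hu : u = saddleCurve lam u.im ↔ u.re = saddleCurveRe lam u.im := by
    rw [Complex.ext_iff, saddleCurve_re, saddleCurve_im]; simp
  rw [isSaddle_iff, Complex.ext_iff, Complex.zero_re, Complex.zero_im,
    im_phaseDeriv_eq_zero_iff a hlam h0 h1 h2, ← hu]
  constructor
  · rintro ⟨h3, h4⟩
    exact ⟨h4, by rwa [← h4]⟩
  · rintro ⟨h3, h4⟩
    exact ⟨by rwa [← h3] at h4, h3⟩

theorem existsUnique_saddle_low {lam a : ℝ} (hlam : 0 < lam) (ha : 0 < a)
    (hbelow : a < (1 + lam) / 2 * lam ^ ((1 - lam) / (1 + lam))) :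
    ∃! u : ℂ, IsSaddle lam a u ∧ 0 < u.im ∧ u.im < Real.pi / (1 + lam) := by
  have hq1 : 0 < Real.pi / (1 + lam) := by have := Real.pi_pos; positivity
  have hanti := strictAntiOn_saddleCurve a hlam
  have hend := phaseDeriv_saddleCurve_end a hlam
  obtain ⟨p, hp⟩ := tendsto_saddleCurve_zero hlam
  have hcont : Continuous fun u => (phaseDeriv lam a u).re := by
    unfold phaseDeriv; fun_prop
  have hpos : ∀ᶠ q in 𝓝[>] (0 : ℝ), 0 < (phaseDeriv lam a (saddleCurve lam q)).re :=
    ((hcont.tendsto _).comp hp).eventually_const_lt (phaseDeriv_real_pos hlam hbelow p)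
  obtain ⟨r, hr, hr0, hr1⟩ := (hpos.and (Ioo_mem_nhdsGT hq1)).exists
  have hcontOn : ContinuousOn (fun q => (phaseDeriv lam a (saddleCurve lam q)).re)
      (Set.Icc r (Real.pi / (1 + lam))) := by
    intro q hq
    obtain ⟨h1, h2⟩ := lt_pi_of_le_pi_div hlam hq.2
    obtain ⟨d, _, h⟩ := saddleCurve_deriv_neg a hlam (hr0.trans_le hq.1) h1 h2
    exact h.continuousAt.continuousWithinAt
  obtain ⟨q, hq, hq2⟩ := intermediate_value_Ioo' hr1.le hcontOn
    (show (0 : ℝ) ∈ Set.Ioo _ _ from ⟨by rw [hend]; linarith, hr⟩)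
  refine ⟨saddleCurve lam q, ⟨?_, ?_, ?_⟩, ?_⟩
  · rw [isSaddle_iff_saddleCurve a hlam] <;> rw [saddleCurve_im]
    · exact ⟨rfl, hq2⟩
    · exact hr0.trans hq.1
    · exact hq.2
  · rw [saddleCurve_im]; exact hr0.trans hq.1
  · rw [saddleCurve_im]; exact hq.2
  · rintro v ⟨hv, hv0, hv1⟩
    obtain ⟨h1, h2⟩ := (isSaddle_iff_saddleCurve a hlam hv0 hv1).1 hv
    have : v.im = q := hanti.injOn ⟨hv0, hv1.le⟩ ⟨hr0.trans hq.1, hq.2.le⟩ (h2.trans hq2.symm)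
    rw [h1, this]

/-- The saddle already found below π/(1+λ) competes in the minimality condition, so a nearest saddle
cannot lie higher. -/
theorem isUpperSaddle_im_lt {lam a : ℝ} (hlam : 0 < lam) (ha : 0 < a)
    (hbelow : a < (1 + lam) / 2 * lam ^ ((1 - lam) / (1 + lam))) {u₀ : ℂ}
    (h : IsUpperSaddle lam a u₀) : u₀.im < Real.pi / (1 + lam) := by
  obtain ⟨u, ⟨hu, h0, h1⟩, -⟩ := existsUnique_saddle_low hlam ha hbelow
  have h2 := h.nearest u hu (by
    rw [abs_of_pos h0]; exact (lt_pi_of_le_pi_div hlam h1.le).1.le)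
  rw [abs_of_pos h0] at h2
  linarith

theorem existsUnique_isUpperSaddle {lam a : ℝ} (hlam : 0 < lam) (ha : 0 < a)
    (hbelow : a < (1 + lam) / 2 * lam ^ ((1 - lam) / (1 + lam))) :
    ∃! u₀ : ℂ, IsUpperSaddle lam a u₀ := by
  obtain ⟨u, ⟨hu, h0, h1⟩, huniq⟩ := existsUnique_saddle_low hlam ha hbelow
  have hup : ∀ v : ℂ, IsSaddle lam a v → 0 < v.im → u.im ≤ v.im := by
    intro v hv hv0
    rcases lt_or_ge v.im (Real.pi / (1 + lam)) with h | h
    · rw [huniq v ⟨hv, hv0, h⟩]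
    · linarith
  refine ⟨u, ⟨hu, h0, (lt_pi_of_le_pi_div hlam h1.le).1.le, fun v hv _ => ?_⟩, fun v hv => ?_⟩
  · rcases lt_trichotomy v.im 0 with h | h | h
    · have := hup (starRingEnd ℂ v) (by
        rw [isSaddle_iff] at hv ⊢
        rw [phaseDeriv_conj, hv, map_zero]) (by simpa using h)
      rw [abs_of_neg h]
      simpa using this
    · exfalso
      have h2 := phaseDeriv_real_pos hlam hbelow v.re
      have h3 : v = (v.re : ℂ) := Complex.ext (by simp) (by simp [h])
      rw [isSaddle_iff] at hv
      rw [← h3, hv] at h2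
      simp at h2
    · rw [abs_of_pos h]; exact hup v hv h
  · exact huniq v ⟨hv.saddle, hv.im_pos, isUpperSaddle_im_lt hlam ha hbelow hv⟩

/-! ### A descent path through the saddle -/

theorem hasDerivAt_phase_re_line (lam a : ℝ) (z d : ℂ) (t : ℝ) :
    HasDerivAt (fun t : ℝ => (phase lam a (z + t * d)).re)
      (phaseDeriv lam a (z + t * d) * d).re t :=
  Complex.reCLM.hasFDerivAt.comp_hasDerivAt t
    (hasDerivAt_comp_line (f := phaseDeriv lam a) (hasDerivAt_phase lam a) z d t)

theorem hasDerivAt_phaseDeriv_re_line (lam a : ℝ) (z d : ℂ) (t : ℝ) :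
    HasDerivAt (fun t : ℝ => (phaseDeriv lam a (z + t * d) * d).re)
      (phaseDeriv2 lam (z + t * d) * d * d).re t :=
  Complex.reCLM.hasFDerivAt.comp_hasDerivAt t
    ((hasDerivAt_comp_line (hasDerivAt_phaseDeriv lam a) z d t).mul_const d)

/-- Because (1 + i)² = 2i, the second derivative of Re h along the diagonal is −2 Im h'', negative
between the real axis and height `q₁`. Thus Re h is strictly concave there. -/
theorem strictAntiOn_phaseDeriv_diagonal {lam : ℝ} (a : ℝ) (hlam : 0 < lam) (u : ℂ) {q₁ : ℝ}
    (h1 : q₁ ≤ Real.pi) (h2 : lam * q₁ ≤ Real.pi) :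
    StrictAntiOn (fun t : ℝ => (phaseDeriv lam a (u + t * (1 + Complex.I)) * (1 + Complex.I)).re)
      (Set.Icc (-u.im) (q₁ - u.im)) := by
  refine strictAntiOn_of_deriv_neg (convex_Icc _ _)
    (fun t _ => (hasDerivAt_phaseDeriv_re_line lam a u _ t).continuousAt.continuousWithinAt)
    fun t ht => ?_
  rw [interior_Icc] at ht
  rw [(hasDerivAt_phaseDeriv_re_line lam a u _ t).deriv]
  have hpos : 0 < (phaseDeriv2 lam (u + t * (1 + Complex.I))).im := by
    have him : (u + t * (1 + Complex.I)).im = u.im + t := by simp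
    refine phaseDeriv2_im_pos hlam ?_ ?_ ?_ <;> rw [him]
    · linarith [ht.1]
    · linarith [ht.2]
    · exact (mul_lt_mul_of_pos_left (by linarith [ht.2]) hlam).trans_le h2
  simp only [Complex.mul_re, Complex.mul_im, Complex.add_re, Complex.add_im, Complex.I_re,
    Complex.I_im, Complex.one_re, Complex.one_im]
  linarith

theorem phase_diagonal_lt {lam a : ℝ} (hlam : 0 < lam) {u : ℂ} (hu : IsSaddle lam a u)
    (h0 : 0 < u.im) {q₁ : ℝ} (hq : u.im < q₁) (h1 : q₁ ≤ Real.pi) (h2 : lam * q₁ ≤ Real.pi) {t : ℝ}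
    (ht : t ∈ Set.Icc (-u.im) (q₁ - u.im)) (ht0 : t ≠ 0) :
    (phase lam a (u + t * (1 + Complex.I))).re < (phase lam a u).re := by
  have hanti := strictAntiOn_phaseDeriv_diagonal a hlam u h1 h2
  have hzero : (phaseDeriv lam a (u + (0 : ℝ) * (1 + Complex.I)) * (1 + Complex.I)).re = 0 := by
    rw [isSaddle_iff] at hu
    simp [hu]
  have hval : (phase lam a u).re = (phase lam a (u + (0 : ℝ) * (1 + Complex.I))).re := by simp
  have hd := hasDerivAt_phase_re_line lam a u (1 + Complex.I)
  have hmem0 : (0 : ℝ) ∈ Set.Icc (-u.im) (q₁ - u.im) := ⟨by linarith, by linarith⟩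
  rw [hval]
  rcases lt_or_gt_of_ne ht0 with h | h
  · refine strictMonoOn_of_deriv_pos (convex_Icc (-u.im) 0)
      (fun s _ => (hd s).continuousAt.continuousWithinAt) (fun s hs => ?_) ⟨ht.1, h.le⟩
      ⟨by linarith, le_rfl⟩ h
    rw [interior_Icc] at hs
    rw [(hd s).deriv, ← hzero]
    exact hanti ⟨hs.1.le, by linarith [hs.2]⟩ hmem0 hs.2
  · refine strictAntiOn_of_deriv_neg (convex_Icc 0 (q₁ - u.im))
      (fun s _ => (hd s).continuousAt.continuousWithinAt) (fun s hs => ?_)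
      ⟨le_rfl, by linarith⟩ ⟨h.le, ht.2⟩ h
    rw [interior_Icc] at hs
    rw [(hd s).deriv, ← hzero]
    exact hanti hmem0 ⟨by linarith [hs.1], hs.2.le⟩ hs.1

/-- On Im u = π, Re h' is (−e^p + λe^{−λp} cos λπ)/2 − a. It decreases in p if cos λπ ≥ 0 and is
negative outright otherwise, so its sign need only be checked at the corner. -/
theorem phase_ray_antitone {lam a : ℝ} (hlam : 0 < lam) (ha : 0 < a) {p₁ p : ℝ} (hp : p₁ ≤ p)
    (h : (phaseDeriv lam a (p₁ + Real.pi * Complex.I)).re ≤ 0) :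
    (phase lam a (p + Real.pi * Complex.I)).re ≤ (phase lam a (p₁ + Real.pi * Complex.I)).re := by
  have hd : ∀ p : ℝ, HasDerivAt (fun p : ℝ => (phase lam a (p + Real.pi * Complex.I)).re)
      (phaseDeriv lam a (p + Real.pi * Complex.I)).re p := fun p => by
    simpa [add_comm] using hasDerivAt_phase_re_line lam a (Real.pi * Complex.I) 1 p
  have hval : ∀ p : ℝ, (phaseDeriv lam a (p + Real.pi * Complex.I)).re =
      (-Real.exp p + lam * (Real.exp (-lam * p) * Real.cos (lam * Real.pi))) / 2 - a := fun p => by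
    rw [phaseDeriv_re]; simp
  refine antitoneOn_of_deriv_nonpos (convex_Ici p₁)
    (fun s _ => (hd s).continuousAt.continuousWithinAt)
    (fun s _ => (hd s).differentiableAt.differentiableWithinAt) (fun s hs => ?_)
    Set.self_mem_Ici hp hp
  rw [interior_Ici, Set.mem_Ioi] at hs
  rw [(hd s).deriv, hval]
  rw [hval] at h
  have h3 : Real.exp (-lam * s) ≤ Real.exp (-lam * p₁) := Real.exp_le_exp.2 (by nlinarith)
  have h4 := Real.exp_le_exp.2 hs.le
  rcases le_or_gt 0 (Real.cos (lam * Real.pi)) with hc | hc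
  · have := mul_le_mul_of_nonneg_left (mul_le_mul_of_nonneg_right h3 hc) hlam.le
    linarith
  · have := mul_neg_of_pos_of_neg (mul_pos hlam (Real.exp_pos (-lam * s))) hc
    have := Real.exp_pos s
    linarith

/-- A path of steep descent from `u` to `∞ + iπ`: a diagonal segment, a vertical one up to the line
`Im = π`, and a horizontal ray. -/
theorem exists_descent_path {lam a : ℝ} (hlam : 0 < lam) (ha : 0 < a) {u : ℂ}
    (hu : IsSaddle lam a u) (h0 : 0 < u.im) (hlt : u.im < Real.pi / (1 + lam)) :
    ∃ q₁ : ℝ, u.im < q₁ ∧ q₁ ≤ Real.pi ∧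
      (∀ t ∈ Set.Icc (-u.im) (q₁ - u.im), t ≠ 0 →
        (phase lam a (u + t * (1 + Complex.I))).re < (phase lam a u).re) ∧
      (∀ q ∈ Set.Icc q₁ Real.pi,
        (phase lam a ((u.re + (q₁ - u.im) : ℝ) + q * Complex.I)).re < (phase lam a u).re) ∧
      ∀ p : ℝ, u.re + (q₁ - u.im) ≤ p → (phase lam a (p + Real.pi * Complex.I)).re ≤
        (phase lam a ((u.re + (q₁ - u.im) : ℝ) + Real.pi * Complex.I)).re := by
  obtain ⟨h1, h2⟩ := lt_pi_of_le_pi_div hlam hlt.le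
  have hpt : ∀ q₁ : ℝ, u + (q₁ - u.im : ℝ) * (1 + Complex.I) =
      ((u.re + (q₁ - u.im) : ℝ) : ℂ) + q₁ * Complex.I := fun q₁ => by
    apply Complex.ext <;> simp
  rcases le_total lam 1 with hl | hl
  -- For λ ≤ 1 the diagonal can run up to height π, and the vertical segment degenerates to a point.
  · have hq2 : lam * Real.pi ≤ Real.pi := by nlinarith [Real.pi_pos]
    have hdiag := fun t => phase_diagonal_lt (t := t) hlam hu h0 h1 le_rfl hq2
    have hmem : Real.pi - u.im ∈ Set.Icc (-u.im) (Real.pi - u.im) :=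
      ⟨by linarith [Real.pi_pos], le_rfl⟩
    refine ⟨Real.pi, h1, le_rfl, hdiag, fun q hq => ?_, fun p hp => ?_⟩
    · obtain rfl : q = Real.pi := le_antisymm hq.2 hq.1
      rw [← hpt]
      exact hdiag _ hmem (by linarith)
    · refine phase_ray_antitone hlam ha hp ?_
      have hanti := strictAntiOn_phaseDeriv_diagonal a hlam u le_rfl hq2
        (show (0 : ℝ) ∈ _ from ⟨by linarith, by linarith⟩) hmem (by linarith)
      simp only [hpt] at hanti
      rw [isSaddle_iff] at hu
      simp only [Complex.ofReal_zero, zero_mul, add_zero, hu, Complex.zero_re] at hanti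
      -- Concavity on the diagonal gives Re h' − Im h' < 0 at the corner; with Im h' ≤ 0 there, Re
      -- h' < 0 follows.
      have him : (phaseDeriv lam a
          ((u.re + (Real.pi - u.im) : ℝ) + Real.pi * Complex.I)).im ≤ 0 := by
        rw [phaseDeriv_im]
        have hs : 0 ≤ Real.sin (lam * Real.pi) :=
          Real.sin_nonneg_of_nonneg_of_le_pi (by have := Real.pi_pos; positivity) hq2
        have := mul_nonneg hlam.le (mul_nonneg (Real.exp_pos
          (-lam * ((u.re + (Real.pi - u.im) : ℝ) + Real.pi * Complex.I : ℂ).re)).le hs)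
        simp at this ⊢
        linarith
      simp only [Complex.mul_re, Complex.add_re, Complex.add_im, Complex.I_re,
        Complex.I_im, Complex.one_re, Complex.one_im] at hanti
      linarith
  -- For λ ≥ 1 the diagonal stops at π/λ, the last height with λq ≤ π. There cos λq = −1, so −cos λq
  -- is maximal at the bottom of the vertical segment, and so is cos q: Re h never exceeds its value
  -- at that corner.
  · have hq1 : Real.pi / lam ≤ Real.pi := div_le_self Real.pi_pos.le hl
    have hq2 : lam * (Real.pi / lam) ≤ Real.pi := by rw [mul_div_cancel₀ _ hlam.ne']
    have hq3 : u.im < Real.pi / lam := by rw [lt_div_iff₀ hlam]; linarith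
    have hdiag := fun t => phase_diagonal_lt (t := t) hlam hu h0 hq3 hq1 hq2
    refine ⟨Real.pi / lam, hq3, hq1, hdiag, fun q hq => ?_, fun p hp => ?_⟩
    · have h3 := hdiag (Real.pi / lam - u.im) ⟨by linarith, le_rfl⟩ (by linarith)
      rw [hpt] at h3
      refine lt_of_le_of_lt ?_ h3
      rw [phase_re, phase_re]
      have h4 : Real.cos q ≤ Real.cos (Real.pi / lam) :=
        Real.cos_le_cos_of_nonneg_of_le_pi (by linarith) hq.2 hq.1
      have h5 := mul_le_mul_of_nonneg_left h4
        (Real.exp_pos (u.re + (Real.pi / lam - u.im))).le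
      have h6 := mul_le_mul_of_nonneg_left (Real.neg_one_le_cos (lam * q))
        (Real.exp_pos (-lam * (u.re + (Real.pi / lam - u.im)))).le
      simp [mul_div_cancel₀ _ hlam.ne', -neg_mul] at h5 h6 ⊢
      linarith
    · refine phase_ray_antitone hlam ha hp ?_
      have him : (phaseDeriv lam a u).im = 0 := by
        rw [(isSaddle_iff lam a u).1 hu, Complex.zero_im]
      rw [phaseDeriv_im] at him
      have hs1 := Real.sin_pos_of_pos_of_lt_pi h0 h1
      -- From u.im ≤ λ u.im ≤ π − u.im. Then Im h'(u) = 0 forces λe^{−λp} ≤ e^p at the saddle, an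
      -- inequality preserved when p increases to the corner.
      have hs : Real.sin u.im ≤ Real.sin (lam * u.im) := by
        have h7 : lam * u.im ≤ Real.pi - u.im := by
          rw [lt_div_iff₀ (by linarith)] at hlt; linarith
        have h8 : u.im ≤ lam * u.im := le_mul_of_one_le_left h0.le hl
        rcases le_total (lam * u.im) (Real.pi / 2) with h9 | h9
        · exact Real.sin_le_sin_of_le_of_le_pi_div_two (by linarith) h9 h8
        · rw [← Real.sin_pi_sub (lam * u.im)]
          exact Real.sin_le_sin_of_le_of_le_pi_div_two (by linarith) (by linarith) (by linarith)
      have hexp : lam * Real.exp (-lam * u.re) ≤ Real.exp u.re := by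
        refine le_of_mul_le_mul_right ?_ hs1
        have := mul_le_mul_of_nonneg_left hs (mul_pos hlam (Real.exp_pos (-lam * u.re))).le
        linarith
      have h10 : Real.exp u.re ≤ Real.exp (u.re + (Real.pi / lam - u.im)) :=
        Real.exp_le_exp.2 (by linarith)
      have h11 : Real.exp (-lam * (u.re + (Real.pi / lam - u.im))) ≤ Real.exp (-lam * u.re) :=
        Real.exp_le_exp.2 (by nlinarith)
      have h12 := mul_le_mul_of_nonneg_left h11 hlam.le
      have h13 := mul_le_mul_of_nonneg_left (Real.cos_le_one (lam * Real.pi))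
        (mul_pos hlam (Real.exp_pos (-lam * (u.re + (Real.pi / lam - u.im))))).le
      rw [phaseDeriv_re]
      simp [-neg_mul] at h13 ⊢
      linarith

/-! ### Branches of the square root -/

theorem sqrt_sq (z : ℂ) : Complex.sqrt z ^ 2 = z := by
  rw [Complex.sqrt]
  exact_mod_cast Complex.cpow_nat_inv_pow z two_ne_zero

theorem sqrt_re_nonneg (z : ℂ) : 0 ≤ (Complex.sqrt z).re := by
  rw [Complex.sqrt, Complex.cpow_inv_two_re]
  exact Real.sqrt_nonneg _

/-- The principal root of a number in the lower half-plane lies in the open fourth quadrant;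
multiplied by i it has positive real part, which decides the sign. -/
theorem sqrt_neg_of_im_pos {z : ℂ} (hz : 0 < z.im) :
    0 < (Complex.sqrt (-z)).re ∧ (Complex.sqrt (-z)).im < 0 ∧
      Complex.sqrt z = Complex.I * Complex.sqrt (-z) := by
  have h1 := sqrt_sq (-z)
  have h2 := sqrt_re_nonneg (-z)
  have h3 := congrArg Complex.im h1
  rw [pow_two, Complex.mul_im, Complex.neg_im] at h3
  have h4 : 0 < (Complex.sqrt (-z)).re := by
    refine lt_of_le_of_ne h2 fun h => ?_
    rw [← h] at h3
    linarith
  have h5 : (Complex.sqrt (-z)).im < 0 := by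
    by_contra hcon
    push Not at hcon
    nlinarith
  refine ⟨h4, h5, ?_⟩
  have h6 : Complex.sqrt z ^ 2 = (Complex.I * Complex.sqrt (-z)) ^ 2 := by
    rw [mul_pow, h1, sqrt_sq, Complex.I_sq]; ring
  rcases sq_eq_sq_iff_eq_or_eq_neg.1 h6 with h | h
  · exact h
  · exfalso
    have h7 := sqrt_re_nonneg z
    rw [h, Complex.neg_re, Complex.I_mul_re] at h7
    linarith

/-! ### Laplace-type estimates and Watson's lemma -/

theorem isBigO_integral_exp_mul {g k : ℝ → ℂ} {a b : ℝ} (hab : a ≤ b)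
    (hg : ContinuousOn g (Set.Icc a b)) (hk : ContinuousOn k (Set.Icc a b))
    (hneg : ∀ t ∈ Set.Icc a b, (g t).re < 0) :
    ∃ η > 0, (fun x : ℝ => ∫ t in a..b, Complex.exp (x * g t) * k t) =O[atTop]
      fun x => Real.exp (-η * x) := by
  obtain ⟨m, hm, hmax⟩ := isCompact_Icc.exists_isMaxOn (Set.nonempty_Icc.2 hab)
    (Complex.continuous_re.comp_continuousOn hg)
  obtain ⟨C, hC⟩ := isCompact_Icc.exists_bound_of_continuousOn hk
  refine ⟨-(g m).re, by linarith [hneg m hm], IsBigO.of_bound (C * |b - a|) ?_⟩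
  filter_upwards [eventually_ge_atTop 0] with x hx
  have h : ∀ t ∈ Set.uIoc a b, ‖Complex.exp (x * g t) * k t‖ ≤ Real.exp (x * (g m).re) * C := by
    intro t ht
    rw [Set.uIoc_of_le hab] at ht
    have ht' := Set.Ioc_subset_Icc_self ht
    rw [norm_mul, Complex.norm_exp, Complex.re_ofReal_mul]
    refine mul_le_mul ?_ (hC t ht') (norm_nonneg _) (Real.exp_pos _).le
    exact Real.exp_le_exp.2 (mul_le_mul_of_nonneg_left (hmax ht') hx)
  refine (intervalIntegral.norm_integral_le_of_norm_le_const h).trans (le_of_eq ?_)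
  rw [Real.norm_of_nonneg (Real.exp_pos _).le, neg_neg, mul_comm x]
  ring

theorem gamma_nat_add_half (k : ℕ) :
    Real.Gamma (k + 1 / 2) = (ascPochhammer ℝ k).eval (1 / 2) * √Real.pi := by
  induction k with
  | zero => simp [-one_div, Real.Gamma_one_half_eq]
  | succ k ih =>
    rw [ascPochhammer_succ_eval, Nat.cast_succ, show (k : ℝ) + 1 + 1 / 2 = (k + 1 / 2) + 1 by ring,
      Real.Gamma_add_one (by positivity), ih]
    ring

theorem integrable_pow_mul_exp_neg_sq (j : ℕ) {x : ℝ} (hx : 0 < x) :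
    MeasureTheory.Integrable (fun w : ℝ => w ^ j * Real.exp (-(x / 2) * w ^ 2)) := by
  simpa using integrable_rpow_mul_exp_neg_mul_sq (half_pos hx)
    (s := j) (by linarith [j.cast_nonneg (α := ℝ)])

theorem integral_odd_pow_mul_exp_neg_sq (k : ℕ) (x : ℝ) :
    ∫ w : ℝ, w ^ (2 * k + 1) * Real.exp (-(x / 2) * w ^ 2) = 0 := by
  have h := MeasureTheory.integral_neg_eq_self
    (fun w : ℝ => w ^ (2 * k + 1) * Real.exp (-(x / 2) * w ^ 2)) MeasureTheory.volume
  simp only [Odd.neg_pow ⟨k, rfl⟩, neg_sq, neg_mul, MeasureTheory.integral_neg] at h ⊢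
  linarith

theorem integral_even_pow_mul_exp_neg_sq (k : ℕ) {x : ℝ} (hx : 0 < x) :
    ∫ w : ℝ, w ^ (2 * k) * Real.exp (-(x / 2) * w ^ 2) =
      √(2 * Real.pi / x) * ((ascPochhammer ℝ k).eval (1 / 2) * (2 / x) ^ k) := by
  have h := integral_rpow_mul_exp_neg_mul_rpow (p := 2) (q := (2 * k : ℕ)) two_pos
    (by linarith [(2 * k).cast_nonneg (α := ℝ)]) (half_pos hx)
  have h2 := integral_comp_abs (f := fun w : ℝ => w ^ (2 * k) * Real.exp (-(x / 2) * w ^ 2))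
  simp only [Even.pow_abs ⟨k, two_mul k⟩, sq_abs] at h2
  simp only [Real.rpow_natCast, Real.rpow_two] at h
  rw [h2, h]
  have e1 : (((2 * k : ℕ) : ℝ) + 1) / 2 = k + 1 / 2 := by push_cast; ring
  have e2 : -(((2 * k : ℕ) : ℝ) + 1) / 2 = -(k + 1 / 2) := by push_cast; ring
  have e3 : (x / 2) ^ (-((k : ℝ) + 1 / 2)) = (2 / x) ^ k * √(2 / x) := by
    rw [Real.rpow_neg (by positivity), ← Real.inv_rpow (by positivity), inv_div,
      Real.rpow_add (by positivity), Real.rpow_natCast, Real.sqrt_eq_rpow]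
  have e4 : √(2 * Real.pi / x) = √(2 / x) * √Real.pi := by
    rw [← Real.sqrt_mul (by positivity)]; ring_nf
  rw [e1, e2, e3, e4, gamma_nat_add_half]
  ring

/-- Watson's lemma for a Gaussian weight, on a small interval around `0`. -/
theorem watson_gaussian {f : ℂ → ℂ} (hf : AnalyticAt ℂ f 0) (N : ℕ) :
    ∃ r₀ > 0, ∀ r : ℝ, 0 < r → r < r₀ →
      (fun x : ℝ => (∫ w in (-r)..r, Complex.exp (-(x / 2) * w ^ 2) * f w) -
        √(2 * Real.pi / x) * ∑ k ∈ Finset.range N,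
          (ascPochhammer ℂ k).eval (1 / 2) * (iteratedDeriv (2 * k) f 0 / ((2 * k).factorial : ℂ)) *
            (2 / x : ℂ) ^ k)
      =O[atTop] fun x : ℝ => x ^ (-(N : ℝ) - 1 / 2) := by
  set c : ℕ → ℂ := fun n => iteratedDeriv n f 0 / (n.factorial : ℂ) with hc
  have hT := hf.hasFPowerSeriesAt.isBigO_sub_partialSum_pow (2 * N)
  obtain ⟨C₀, hC₀⟩ := hT.bound
  obtain ⟨r₀, hr₀, hball⟩ := Metric.eventually_nhds_iff_ball.1 (hC₀.and hf.eventually_analyticAt)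
  refine ⟨r₀, hr₀, fun r hr hrr => ?_⟩
  have hin : ∀ w : ℝ, w ∈ Set.Icc (-r) r → (w : ℂ) ∈ Metric.ball (0 : ℂ) r₀ := by
    intro w hw
    rw [mem_ball_zero_iff, Complex.norm_real, Real.norm_eq_abs]
    exact (abs_le.2 hw).trans_lt hrr
  have hcont : ContinuousOn (fun w : ℝ => f w) (Set.Icc (-r) r) := fun w hw =>
    (ContinuousAt.comp (f := fun w : ℝ => (w : ℂ)) (hball _ (hin w hw)).2.continuousAt
      Complex.continuous_ofReal.continuousAt).continuousWithinAt
  set T : ℝ → ℂ := fun w => ∑ j ∈ Finset.range (2 * N), c j * (w : ℂ) ^ j with hTdef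
  have hin' : ∀ w : ℝ, w ∈ Set.Ioc (-r) r → ‖f w - T w‖ ≤ C₀ * |w| ^ (2 * N) := by
    intro w hw
    have h := (hball _ (hin w (Set.Ioc_subset_Icc_self hw))).1
    simpa [hTdef, hc, FormalMultilinearSeries.partialSum, FormalMultilinearSeries.ofScalars,
      mul_comm] using h
  set g : ℝ → ℂ := fun w => (Set.Ioc (-r) r).indicator (fun w : ℝ => f w) w - T w with hg
  set D : ℝ := ∑ j ∈ Finset.range (2 * N), ‖c j‖ * (r⁻¹) ^ (2 * N - j) with hD
  have hD0 : 0 ≤ D := Finset.sum_nonneg fun j _ => by positivity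
  -- The bound holds on the whole line: outside the interval f is replaced by 0, and |w|/r ≥ 1
  -- raises each lower power in `T` to degree 2N. No separate tail estimate is needed, and the error
  -- is bounded by a Gaussian moment.
  have hgb : ∀ w, ‖g w‖ ≤ (|C₀| + D) * |w| ^ (2 * N) := by
    intro w
    by_cases hw : w ∈ Set.Ioc (-r) r
    · simp only [hg, Set.indicator_of_mem hw]
      refine (hin' w hw).trans ?_
      gcongr
      linarith [le_abs_self C₀]
    · have hwr : r ≤ |w| := by
        rw [Set.mem_Ioc, not_and_or, not_lt, not_le] at hw
        rcases hw with h | h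
        · rw [le_abs]; right; linarith
        · rw [le_abs]; left; linarith
      have hw1 : 1 ≤ r⁻¹ * |w| := by
        rw [inv_mul_eq_div, one_le_div hr]; exact hwr
      simp only [hg, Set.indicator_of_notMem hw, zero_sub, norm_neg]
      have h1 : ‖T w‖ ≤ D * |w| ^ (2 * N) := by
        rw [hD, Finset.sum_mul]
        refine (norm_sum_le _ _).trans (Finset.sum_le_sum fun j hj => ?_)
        have hj' : j ≤ 2 * N := (Finset.mem_range.1 hj).le
        rw [norm_mul, norm_pow, Complex.norm_real, Real.norm_eq_abs, mul_assoc]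
        refine mul_le_mul_of_nonneg_left ?_ (norm_nonneg _)
        calc |w| ^ j ≤ |w| ^ j * (r⁻¹ * |w|) ^ (2 * N - j) :=
              le_mul_of_one_le_right (by positivity) (one_le_pow₀ hw1)
          _ = r⁻¹ ^ (2 * N - j) * |w| ^ (2 * N) := by
              rw [mul_pow, ← Nat.sub_add_cancel hj', pow_add (|w|)]
              simp
              ring
      refine h1.trans ?_
      gcongr
      linarith [abs_nonneg C₀]
  have hexp : ∀ x w : ℝ, Complex.exp (-(x / 2) * w ^ 2) = (Real.exp (-(x / 2) * w ^ 2) : ℝ) :=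
    fun x w => by push_cast; rfl
  have hmom : ∀ (x : ℝ) (j : ℕ), ∫ w : ℝ, Complex.exp (-(x / 2) * w ^ 2) * (c j * (w : ℂ) ^ j) =
      c j * ((∫ w : ℝ, w ^ j * Real.exp (-(x / 2) * w ^ 2) : ℝ) : ℂ) := by
    intro x j
    rw [← integral_complex_ofReal, ← MeasureTheory.integral_const_mul]
    congr 1
    ext w
    rw [hexp]
    push_cast; ring
  have hmomi : ∀ (x : ℝ), 0 < x → ∀ (j : ℕ), MeasureTheory.Integrable
      (fun w : ℝ => Complex.exp (-(x / 2) * w ^ 2) * (c j * (w : ℂ) ^ j)) := by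
    intro x hx j
    refine ((integrable_pow_mul_exp_neg_sq j hx).ofReal (𝕜 := ℂ) |>.const_mul (c j)).congr
      (Eventually.of_forall fun w => ?_)
    change c j * ((w ^ j * Real.exp (-(x / 2) * w ^ 2) : ℝ) : ℂ) =
      Complex.exp (-(x / 2) * w ^ 2) * (c j * (w : ℂ) ^ j)
    rw [hexp]
    push_cast; ring
  have hsum : ∀ x : ℝ, 0 < x → ∫ w : ℝ, Complex.exp (-(x / 2) * w ^ 2) * T w =
      √(2 * Real.pi / x) * ∑ k ∈ Finset.range N,
          (ascPochhammer ℂ k).eval (1 / 2) * c (2 * k) * (2 / x : ℂ) ^ k := by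
    intro x hx
    simp only [hTdef, Finset.mul_sum]
    rw [MeasureTheory.integral_finsetSum _ fun j _ => hmomi x hx j]
    simp only [hmom]
    clear_value c
    clear * - hx
    induction N with
    | zero => simp
    | succ N ih =>
      rw [mul_add, mul_one, Finset.sum_range_succ, Finset.sum_range_succ, ih,
        Finset.sum_range_succ, integral_odd_pow_mul_exp_neg_sq,
        integral_even_pow_mul_exp_neg_sq N hx]
      have : (((ascPochhammer ℝ N).eval (1 / 2) : ℝ) : ℂ) = (ascPochhammer ℂ N).eval (1 / 2) := by
        have := (ascPochhammer ℝ N).eval_map_apply (Complex.ofRealHom) (1 / 2)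
        rw [ascPochhammer_map] at this
        simpa using this.symm
      push_cast
      rw [this]
      ring
  have hkey : ∀ x : ℝ, 0 < x → (∫ w in (-r)..r, Complex.exp (-(x / 2) * w ^ 2) * f w) -
      √(2 * Real.pi / x) * ∑ k ∈ Finset.range N,
          (ascPochhammer ℂ k).eval (1 / 2) * c (2 * k) * (2 / x : ℂ) ^ k =
      ∫ w : ℝ, Complex.exp (-(x / 2) * w ^ 2) * g w := by
    intro x hx
    have hfi : MeasureTheory.IntegrableOn
        (fun w : ℝ => Complex.exp (-(x / 2) * w ^ 2) * f w) (Set.Ioc (-r) r) :=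
      (ContinuousOn.integrableOn_Icc (ContinuousOn.mul (by fun_prop) hcont)).mono_set
        Set.Ioc_subset_Icc_self
    have hTi : MeasureTheory.Integrable
        (fun w : ℝ => Complex.exp (-(x / 2) * w ^ 2) * T w) := by
      simp only [hTdef, Finset.mul_sum]
      exact MeasureTheory.integrable_finsetSum _ fun j _ => hmomi x hx j
    rw [← hsum x hx, intervalIntegral.integral_of_le (by linarith),
      ← MeasureTheory.integral_indicator measurableSet_Ioc,
      ← MeasureTheory.integral_sub (hfi.integrable_indicator measurableSet_Ioc) hTi]
    congr 1
    ext w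
    by_cases hw : w ∈ Set.Ioc (-r) r <;> simp [hg, hw, mul_sub]
  refine IsBigO.of_bound ((|C₀| + D) * |√(2 * Real.pi) * ((ascPochhammer ℝ N).eval (1 / 2) * 2 ^ N)|)
    ?_
  filter_upwards [eventually_gt_atTop 0] with x hx
  rw [hkey x hx]
  have hle : ‖∫ w : ℝ, Complex.exp (-(x / 2) * w ^ 2) * g w‖ ≤
      ∫ w : ℝ, (|C₀| + D) * (w ^ (2 * N) * Real.exp (-(x / 2) * w ^ 2)) := by
    refine MeasureTheory.norm_integral_le_of_norm_le
      ((integrable_pow_mul_exp_neg_sq _ hx).const_mul _) (Eventually.of_forall fun w => ?_)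
    rw [norm_mul, hexp, Complex.norm_real, Real.norm_of_nonneg (Real.exp_pos _).le]
    have := hgb w
    rw [Even.pow_abs ⟨N, two_mul N⟩] at this
    calc _ ≤ Real.exp (-(x / 2) * w ^ 2) * ((|C₀| + D) * w ^ (2 * N)) := by gcongr
      _ = _ := by ring
  refine hle.trans (le_of_eq ?_)
  rw [MeasureTheory.integral_const_mul, integral_even_pow_mul_exp_neg_sq N hx,
    Real.norm_of_nonneg (by positivity), mul_assoc]
  have hp : 0 ≤ (ascPochhammer ℝ N).eval (1 / 2 : ℝ) := by
    have := gamma_nat_add_half N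
    have h2 : 0 < Real.Gamma (N + 1 / 2) := Real.Gamma_pos_of_pos (by positivity)
    rw [this] at h2
    exact (pos_of_mul_pos_left h2 (Real.sqrt_nonneg _)).le
  congr 1
  rw [abs_of_nonneg (by positivity), Real.rpow_sub hx, Real.rpow_neg hx.le, Real.rpow_natCast,
    ← Real.sqrt_eq_rpow, Real.sqrt_div (by positivity), div_pow]
  field_simp

/-! ### Local inversion and the contribution of the saddle -/

/-- Write h − h(u₀) = (u − u₀)² g with g entire and 2g(u₀) = h₀''. Then w = (u − u₀)√(−2g) is
analytic near u₀, because −h₀'' lies off the cut, and has derivative √(−h₀'') ≠ 0 there; its local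
inverse is φ. -/
theorem exists_isSaddleInversion {lam a : ℝ} {u₀ : ℂ} (hu : IsSaddle lam a u₀)
    (him : 0 < (phaseDeriv2 lam u₀).im) : ∃ φ : ℂ → ℂ, IsSaddleInversion lam a u₀ φ := by
  set H := phaseDeriv2 lam u₀ with hH
  obtain ⟨hs1, hs2, -⟩ := sqrt_neg_of_im_pos him
  have hs0 : Complex.sqrt (-H) ≠ 0 := fun h => by rw [h] at hs1; simp at hs1
  set k : ℂ → ℂ := fun u => phase lam a u - phase lam a u₀ with hk
  have hkd : Differentiable ℂ k := (differentiable_phase lam a).sub_const _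
  have hkderiv : ∀ u, HasDerivAt k (phaseDeriv lam a u) u := fun u =>
    (hasDerivAt_phase lam a u).sub_const _
  have hk1 : Differentiable ℂ (dslope k u₀) := by
    rw [← differentiableOn_univ, Complex.differentiableOn_dslope univ_mem]
    exact hkd.differentiableOn
  set g := dslope (dslope k u₀) u₀ with hg
  have hg1 : Differentiable ℂ g := by
    rw [← differentiableOn_univ, Complex.differentiableOn_dslope univ_mem]
    exact hk1.differentiableOn
  have hkz : k u₀ = 0 := sub_self _
  have hk1z : dslope k u₀ u₀ = 0 := by
    rw [dslope_same, (hkderiv u₀).deriv]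
    exact (isSaddle_iff lam a u₀).1 hu
  have hfac : ∀ u, k u = (u - u₀) ^ 2 * g u := by
    intro u
    have h1 := sub_smul_dslope k u₀ u
    have h2 := sub_smul_dslope (dslope k u₀) u₀ u
    rw [hkz, sub_zero, smul_eq_mul] at h1
    rw [hk1z, sub_zero, smul_eq_mul] at h2
    rw [← h1, ← h2]; ring
  have hg0 : 2 * g u₀ = H := by
    have hgd := fun u => (hg1 u).hasDerivAt
    have hgd' : Differentiable ℂ (deriv g) := by
      rw [← differentiableOn_univ]
      exact hg1.differentiableOn.deriv isOpen_univ
    have hq : ∀ u, HasDerivAt (fun u => (u - u₀) ^ 2) (2 * (u - u₀)) u := fun u => by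
      simpa using ((hasDerivAt_id u).sub_const u₀).fun_pow 2
    have h1 : phaseDeriv lam a = fun u => 2 * (u - u₀) * g u + (u - u₀) ^ 2 * deriv g u := by
      ext u
      refine (hkderiv u).unique ?_
      rw [show k = fun u => (u - u₀) ^ 2 * g u from funext hfac]
      exact (hq u).mul (hgd u)
    have h2 := hasDerivAt_phaseDeriv lam a u₀
    rw [h1] at h2
    have hl : HasDerivAt (fun u => 2 * (u - u₀)) 2 u₀ := by
      simpa using ((hasDerivAt_id u₀).sub_const u₀).const_mul (2 : ℂ)
    have h3 := (hl.mul (hgd u₀)).add ((hq u₀).mul (hgd' u₀).hasDerivAt)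
    have h4 := h2.unique h3
    simp at h4
    rw [hH, h4]
  set S : ℂ → ℂ := fun u => (u - u₀) * Complex.sqrt (-(2 * g u)) with hS
  have hslit : -(2 * g u₀) ∈ Complex.slitPlane := by
    rw [hg0, Complex.mem_slitPlane_iff]
    right
    rw [Complex.neg_im]
    linarith
  have hSan : AnalyticAt ℂ S u₀ := by
    have h1 : AnalyticAt ℂ (fun u => -(2 * g u)) u₀ := ((hg1.const_mul 2).neg).analyticAt u₀
    have h2 : AnalyticAt ℂ (fun u => u - u₀) u₀ :=
      (differentiable_id.sub_const u₀).analyticAt u₀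
    exact h2.mul (h1.cpow analyticAt_const hslit)
  have hSd : deriv S u₀ = Complex.sqrt (-H) := by
    have h1 : AnalyticAt ℂ (fun u => Complex.sqrt (-(2 * g u))) u₀ :=
      (((hg1.const_mul 2).neg).analyticAt u₀).cpow analyticAt_const hslit
    have h2 := ((hasDerivAt_id u₀).sub_const u₀).mul h1.differentiableAt.hasDerivAt
    have h3 := h2.deriv
    simp only [id, sub_self, zero_mul, add_zero, one_mul, hg0] at h3
    exact h3
  have hSd0 : deriv S u₀ ≠ 0 := by rwa [hSd]
  have hSz : S u₀ = 0 := by simp [hS]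
  have hSsq : ∀ u, -(S u ^ 2 / 2) = k u := by
    intro u
    rw [hS]
    simp only
    rw [mul_pow, sqrt_sq, hfac]; ring
  have hstr := hSan.hasStrictDerivAt
  have hloc := hSan.analyticAt_localInverse hSd0
  have hder := hstr.to_localInverse hSd0
  have hrinv := hstr.eventually_right_inverse hSd0
  rw [hSz] at hloc hder hrinv
  refine ⟨hstr.localInverse _ _ _ hSd0, hloc, ?_, ?_, ?_⟩
  · have := (hstr.hasStrictFDerivAt_equiv hSd0).localInverse_apply_image
    rwa [hSz] at this
  · rw [hder.hasDerivAt.deriv, hSd, phaseSecond_eq, one_div]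
  · filter_upwards [hrinv] with w hw
    have h := hSsq (hstr.localInverse _ _ _ hSd0 w)
    rwa [hw] at h

/-- The chord of a disc contained in the cone `|Im w| < Re w` contributes exponentially little. -/
theorem isBigO_segment {f : ℂ → ℂ} {ρ : ℝ} (hf : ContinuousOn f (Metric.ball 0 ρ)) {z₁ z₂ : ℂ}
    (h1 : z₁ ∈ Metric.ball (0 : ℂ) ρ) (h2 : z₂ ∈ Metric.ball (0 : ℂ) ρ) (σ : ℝ) (hσ : σ ^ 2 = 1)
    (hc1 : |z₁.im| < σ * z₁.re) (hc2 : |z₂.im| < σ * z₂.re) :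
    ∃ η > 0, (fun x : ℝ => ∫ t in (0 : ℝ)..1, Complex.exp (x * (-((z₁ + t * (z₂ - z₁)) ^ 2 / 2))) *
      (f (z₁ + t * (z₂ - z₁)) * (z₂ - z₁))) =O[atTop] fun x => Real.exp (-η * x) := by
  have hball : ∀ t ∈ Set.Icc (0 : ℝ) 1, z₁ + t * (z₂ - z₁) ∈ Metric.ball (0 : ℂ) ρ := by
    intro t ht
    have := (convex_ball (0 : ℂ) ρ).add_smul_sub_mem h1 h2 ht
    simpa using this
  refine isBigO_integral_exp_mul zero_le_one (by fun_prop)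
    (ContinuousOn.mul (hf.comp (by fun_prop) hball) continuousOn_const) fun t ht => ?_
  have hre : (z₁ + t * (z₂ - z₁)).re = (1 - t) * z₁.re + t * z₂.re := by
    simp; ring
  have him : (z₁ + t * (z₂ - z₁)).im = (1 - t) * z₁.im + t * z₂.im := by
    simp; ring
  have hlt : |(z₁ + t * (z₂ - z₁)).im| < σ * (z₁ + t * (z₂ - z₁)).re := by
    rw [hre, him]
    have ht0 := ht.1
    have ht1 : 0 ≤ 1 - t := by linarith [ht.2]
    rw [abs_lt] at hc1 hc2 ⊢
    rcases ht0.lt_or_eq with h | rfl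
    · constructor <;> nlinarith [mul_lt_mul_of_pos_left hc2.1 h, mul_lt_mul_of_pos_left hc2.2 h,
        mul_le_mul_of_nonneg_left hc1.1.le ht1, mul_le_mul_of_nonneg_left hc1.2.le ht1]
    · constructor <;> linarith
  set w := z₁ + t * (z₂ - z₁)
  have h3 : w.im ^ 2 < (σ * w.re) ^ 2 := sq_lt_sq' (by linarith [(abs_lt.1 hlt).1]) (abs_lt.1 hlt).2
  rw [mul_pow, hσ, one_mul] at h3
  have h4 : (w ^ 2).re = w.re ^ 2 - w.im ^ 2 := by rw [pow_two, Complex.mul_re]; ring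
  simp [h4]
  linarith

theorem isBigO_exp_neg_mul_rpow {η : ℝ} (hη : 0 < η) (p : ℝ) :
    (fun x : ℝ => Real.exp (-η * x)) =O[atTop] fun x : ℝ => x ^ p :=
  (isLittleO_exp_neg_mul_rpow_atTop hη p).isBigO

/-- In the w-plane the diagonal segment runs between points ω(±ε), not along ℝ. A primitive allows
it to be replaced by the interval [−r, r] and two chords in the sectors |Im w| < ±Re w, where Re w²
> 0 makes them exponentially small. -/
theorem isBigO_saddle_local {lam a : ℝ} {u₀ : ℂ} {φ : ℂ → ℂ} (hφ : IsSaddleInversion lam a u₀ φ)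
    (him : 0 < (phaseDeriv2 lam u₀).im) (N : ℕ) {δ : ℝ} (hδ : 0 < δ) :
    ∃ ε : ℝ, 0 < ε ∧ ε < δ ∧
      (fun x : ℝ => (∫ t in (-ε)..ε, Complex.exp (x *
          (phase lam a (u₀ + t * (1 + Complex.I)) - phase lam a u₀)) * (1 + Complex.I)) -
        √(2 * Real.pi / x) * ∑ k ∈ Finset.range N, (ascPochhammer ℂ k).eval (1 / 2) *
          (iteratedDeriv (2 * k) (deriv φ) 0 / ((2 * k).factorial : ℂ)) * (2 / x : ℂ) ^ k)
      =O[atTop] fun x : ℝ => x ^ (-(N : ℝ) - 1 / 2) := by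
  set H := phaseDeriv2 lam u₀ with hH
  obtain ⟨hs1, hs2, -⟩ := sqrt_neg_of_im_pos him
  set s := Complex.sqrt (-H) with hs
  have hs0 : s ≠ 0 := fun h => by rw [h] at hs1; simp at hs1
  have hd0 : deriv φ 0 = 1 / s := by rw [hφ.deriv_zero, phaseSecond_eq]
  have hd0' : deriv φ 0 ≠ 0 := by rw [hd0]; exact one_div_ne_zero hs0
  have hstr := hφ.analytic.hasStrictDerivAt
  set ψ := hstr.localInverse _ _ _ hd0' with hψ
  have hψd : HasDerivAt ψ s u₀ := by
    have h := (hstr.to_localInverse hd0').hasDerivAt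
    rw [hφ.map_zero] at h
    exact h.congr_deriv (by rw [hd0, one_div, inv_inv])
  have hψ0 : ψ u₀ = 0 := by
    have h := (hstr.hasStrictFDerivAt_equiv hd0').localInverse_apply_image
    rwa [hφ.map_zero] at h
  have hψr : ∀ᶠ u in 𝓝 u₀, φ (ψ u) = u := by
    have h := hstr.eventually_right_inverse hd0'
    rwa [hφ.map_zero] at h
  obtain ⟨ρ, hρ, hball⟩ := Metric.eventually_nhds_iff_ball.1
    (hφ.phase_eq.and hφ.analytic.eventually_analyticAt)
  obtain ⟨r₀, hr₀, hwatson⟩ := watson_gaussian hφ.analytic.deriv N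
  obtain ⟨r, hr, hrρ, hrr₀⟩ : ∃ r : ℝ, 0 < r ∧ r < ρ ∧ r < r₀ := by
    obtain ⟨r, h1, h2⟩ := exists_between (lt_min hρ hr₀)
    exact ⟨r, h1, lt_min_iff.1 h2⟩
  set ω : ℝ → ℂ := fun t => ψ (u₀ + t * (1 + Complex.I)) with hω
  have hω0 : ω 0 = 0 := by simp [hω, hψ0]
  have hline : HasDerivAt (fun t : ℝ => u₀ + (t : ℂ) * (1 + Complex.I)) (1 + Complex.I) 0 := by
    simpa using ((Complex.ofRealCLM.hasDerivAt (x := (0 : ℝ))).mul_const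
      (1 + Complex.I)).const_add u₀
  have hωd : HasDerivAt ω (s * (1 + Complex.I)) 0 := by
    refine HasDerivAt.comp (h₂ := ψ) (0 : ℝ) ?_ hline
    simpa using hψd
  -- The tangent s(1 + i) has real part s.re − s.im and imaginary part s.re + s.im; since s.re > 0 >
  -- s.im, it lies in the open sector about the positive axis.
  have hcone : ∀ᶠ t in 𝓝[≠] (0 : ℝ), |(t⁻¹ • ω t).im| < (t⁻¹ • ω t).re := by
    have h := hωd.tendsto_slope
    have h2 : Tendsto (fun t : ℝ => t⁻¹ • ω t) (𝓝[≠] 0) (𝓝 (s * (1 + Complex.I))) := by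
      simpa [slope_fun_def, hω0] using h
    have hopen : IsOpen {z : ℂ | |z.im| < z.re} := isOpen_lt (by fun_prop) (by fun_prop)
    refine h2.eventually (hopen.mem_nhds ?_)
    simp only [Set.mem_ofPred_eq, Complex.mul_re, Complex.mul_im, Complex.add_re, Complex.add_im,
      Complex.one_re, Complex.one_im, Complex.I_re, Complex.I_im]
    rw [abs_lt]
    constructor <;> linarith
  rw [eventually_nhdsWithin_iff] at hcone
  have hev : ∀ᶠ t in 𝓝 (0 : ℝ), ω t ∈ Metric.ball (0 : ℂ) ρ ∧
      φ (ω t) = u₀ + t * (1 + Complex.I) := by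
    have h1 := hωd.continuousAt.tendsto
    rw [hω0] at h1
    have h2 := hline.continuousAt.tendsto
    simp only [Complex.ofReal_zero, zero_mul, add_zero] at h2
    exact (h1.eventually (Metric.ball_mem_nhds 0 hρ)).and (h2.eventually hψr)
  obtain ⟨ε₁, hε₁, hall⟩ := Metric.eventually_nhds_iff_ball.1 (hcone.and hev)
  obtain ⟨ε, hε, hεδ, hεε⟩ : ∃ ε : ℝ, 0 < ε ∧ ε < δ ∧ ε < ε₁ := by
    obtain ⟨r, h1, h2⟩ := exists_between (lt_min hδ hε₁)
    exact ⟨r, h1, lt_min_iff.1 h2⟩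
  refine ⟨ε, hε, hεδ, ?_⟩
  obtain ⟨hc1, hb1, he1⟩ := hall ε (by simpa [abs_of_pos hε] using hεε)
  obtain ⟨hc2, hb2, he2⟩ := hall (-ε) (by simpa [abs_of_pos hε] using hεε)
  have hc1' : |(ω ε).im| < 1 * (ω ε).re := by
    have h := hc1 hε.ne'
    rw [Complex.smul_re, Complex.smul_im, smul_eq_mul, smul_eq_mul, abs_mul,
      abs_of_pos (inv_pos.2 hε)] at h
    rw [one_mul]
    exact lt_of_mul_lt_mul_left h (inv_pos.2 hε).le
  have hc2' : |(ω (-ε)).im| < -1 * (ω (-ε)).re := by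
    have h := hc2 (neg_ne_zero.2 hε.ne')
    rw [Complex.smul_re, Complex.smul_im, smul_eq_mul, smul_eq_mul, abs_mul, inv_neg, abs_neg,
      abs_of_pos (inv_pos.2 hε), neg_mul, ← mul_neg] at h
    rw [neg_one_mul]
    exact lt_of_mul_lt_mul_left h (inv_pos.2 hε).le
  have hφcont : ContinuousOn (deriv φ) (Metric.ball 0 ρ) := fun w hw =>
    (hball w hw).2.deriv.continuousAt.continuousWithinAt
  have hrb : (r : ℂ) ∈ Metric.ball (0 : ℂ) ρ := by simpa [abs_of_pos hr] using hrρ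
  have hrb' : (-r : ℂ) ∈ Metric.ball (0 : ℂ) ρ := by simpa [abs_of_pos hr] using hrρ
  obtain ⟨η₁, hη₁, hseg1⟩ := isBigO_segment hφcont hrb hb1 1 (by norm_num) (by simpa) hc1'
  obtain ⟨η₂, hη₂, hseg2⟩ := isBigO_segment hφcont hb2 hrb' (-1) (by norm_num) hc2' (by simpa)
  have hmid := hwatson r hr hrr₀
  refine (((hseg1.trans (isBigO_exp_neg_mul_rpow hη₁ _)).add
    (hseg2.trans (isBigO_exp_neg_mul_rpow hη₂ _))).add hmid).congr_left fun x => ?_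
  obtain ⟨F, hF⟩ := exists_primitive
    (f := fun u => Complex.exp (x * (phase lam a u - phase lam a u₀)))
    (by have := differentiable_phase lam a; fun_prop)
  have hG : ∀ w ∈ Metric.ball (0 : ℂ) ρ, HasDerivAt (fun w => F (φ w))
      (Complex.exp (x * (-(w ^ 2 / 2))) * deriv φ w) w := by
    intro w hw
    have h := (hF (φ w)).comp w (hball w hw).2.differentiableAt.hasDerivAt
    rwa [← (hball w hw).1] at h
  have hsegval : ∀ z₁ ∈ Metric.ball (0 : ℂ) ρ, ∀ z₂ ∈ Metric.ball (0 : ℂ) ρ,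
      ∫ t in (0 : ℝ)..1, Complex.exp (x * (-((z₁ + t * (z₂ - z₁)) ^ 2 / 2))) *
        (deriv φ (z₁ + t * (z₂ - z₁)) * (z₂ - z₁)) = F (φ z₂) - F (φ z₁) := by
    intro z₁ h1 z₂ h2
    have hin : ∀ t ∈ Set.Icc (0 : ℝ) 1, z₁ + t * (z₂ - z₁) ∈ Metric.ball (0 : ℂ) ρ := fun t ht => by
      simpa using (convex_ball (0 : ℂ) ρ).add_smul_sub_mem h1 h2 ht
    refine (intervalIntegral.integral_eq_sub_of_hasDerivAt
      (f := fun t : ℝ => F (φ (z₁ + t * (z₂ - z₁)))) (fun t ht => ?_) ?_).trans (by simp)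
    · rw [Set.uIcc_of_le zero_le_one] at ht
      have hl : HasDerivAt (fun t : ℝ => z₁ + (t : ℂ) * (z₂ - z₁)) (z₂ - z₁) t := by
        simpa using ((Complex.ofRealCLM.hasDerivAt (x := t)).mul_const (z₂ - z₁)).const_add z₁
      rw [← mul_assoc]
      exact HasDerivAt.comp (h₂ := fun w => F (φ w)) t (hG _ (hin t ht)) hl
    · refine ContinuousOn.intervalIntegrable ?_
      rw [Set.uIcc_of_le zero_le_one]
      exact ContinuousOn.mul (by fun_prop)
        (ContinuousOn.mul (hφcont.comp (by fun_prop) hin) continuousOn_const)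
  have hmidval : ∫ w in (-r)..r, Complex.exp (-(x / 2) * w ^ 2) * deriv φ w =
      F (φ r) - F (φ (-r)) := by
    have hin : ∀ w ∈ Set.Icc (-r) r, (w : ℂ) ∈ Metric.ball (0 : ℂ) ρ := fun w hw => by
      rw [mem_ball_zero_iff, Complex.norm_real, Real.norm_eq_abs]
      exact (abs_le.2 hw).trans_lt hrρ
    refine (intervalIntegral.integral_eq_sub_of_hasDerivAt
      (f := fun w : ℝ => F (φ w)) (fun w hw => ?_) ?_).trans (by simp)
    · rw [Set.uIcc_of_le (by linarith)] at hw
      refine (hG w (hin w hw)).comp_ofReal.congr_deriv ?_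
      ring_nf
    · refine ContinuousOn.intervalIntegrable ?_
      rw [Set.uIcc_of_le (by linarith)]
      exact ContinuousOn.mul (by fun_prop) (hφcont.comp (by fun_prop) hin)
  have hdiag := integral_line_eq_sub hF
    (by have := (differentiable_phase lam a).continuous; fun_prop) u₀ (1 + Complex.I) (-ε) ε
  rw [hsegval _ hrb _ hb1, hsegval _ hb2 _ hrb', hmidval, hdiag, he1, he2]
  ring

/-! ### Contour deformation and assembly -/

/-- The exponential integrand, normalized to have the value `1` at `u₀`. -/
noncomputable def normalizedExp (lam a : ℝ) (u₀ : ℂ) (x : ℝ) (u : ℂ) : ℂ :=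
  Complex.exp (x * (phase lam a u - phase lam a u₀))

theorem differentiable_normalizedExp (lam a : ℝ) (u₀ : ℂ) (x : ℝ) :
    Differentiable ℂ (normalizedExp lam a u₀ x) := by
  have := differentiable_phase lam a
  unfold normalizedExp; fun_prop

theorem norm_normalizedExp (lam a : ℝ) (u₀ : ℂ) (x : ℝ) (u : ℂ) :
    ‖normalizedExp lam a u₀ x u‖ =
      Real.exp (x * ((phase lam a u).re - (phase lam a u₀).re)) := by
  rw [normalizedExp, Complex.norm_exp, Complex.re_ofReal_mul, Complex.sub_re]

theorem exp_mul_normalizedExp (lam a : ℝ) (u₀ : ℂ) (x : ℝ) (u : ℂ) :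
    Complex.exp (x * phase lam a u₀) * normalizedExp lam a u₀ x u =
      Complex.exp (x * phase lam a u) := by
  rw [normalizedExp, ← Complex.exp_add]; ring_nf

theorem integrableOn_normalizedExp_ray {lam a : ℝ} (hlam : 0 < lam) (ha : 0 < a) (u₀ : ℂ) {x : ℝ}
    (hx : 0 < x) (P : ℝ) : MeasureTheory.IntegrableOn
      (fun p : ℝ => normalizedExp lam a u₀ x (p + Real.pi * Complex.I)) (Set.Ioi P) := by
  refine integrableOn_Ioi_of_le_exp (b := x * a)
    (C := Real.exp (x * (Real.exp (-lam * P) / 2 - (phase lam a u₀).re)))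
    ((differentiable_normalizedExp lam a u₀ x).continuous.comp (by fun_prop)) (mul_pos hx ha)
    fun p hp => ?_
  rw [Function.comp_apply, norm_normalizedExp, ← Real.exp_add, Real.exp_le_exp]
  have h1 : (phase lam a (p + Real.pi * Complex.I)).re ≤ Real.exp (-lam * P) / 2 - a * p := by
    have h2 : Real.exp (-lam * p) ≤ Real.exp (-lam * P) := Real.exp_le_exp.2 (by nlinarith)
    have h3 := mul_le_mul_of_nonneg_left (Real.neg_one_le_cos (lam * Real.pi))
      (Real.exp_pos (-lam * p)).le
    have h4 := Real.exp_pos p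
    rw [phase_re]
    simp [-neg_mul]
    linarith
  have := mul_le_mul_of_nonneg_left h1 hx.le
  linarith

/-- Deformation of the keyhole contour onto a path through `u₀`; the part of the path on the real
axis does not contribute to the imaginary part. -/
theorem keyhole_im_eq_path {lam a : ℝ} (hlam : 0 < lam) (ha : 0 < a) (u₀ : ℂ) {x : ℝ}
    (hx : 0 < x) (q₁ : ℝ) :
    (keyhole (fun u => Complex.exp (x * phase lam a u)) 0).im =
      (Complex.exp (x * phase lam a u₀) *
        ((∫ t in (-u₀.im)..(q₁ - u₀.im),
            normalizedExp lam a u₀ x (u₀ + t * (1 + Complex.I)) * (1 + Complex.I)) +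
          (∫ q in q₁..Real.pi,
            normalizedExp lam a u₀ x ((u₀.re + (q₁ - u₀.im) : ℝ) + q * Complex.I) * Complex.I) +
          ∫ p in Set.Ioi (u₀.re + (q₁ - u₀.im)),
            normalizedExp lam a u₀ x (p + Real.pi * Complex.I))).im := by
  set E := Complex.exp (x * phase lam a u₀) with hE
  have hdiff := differentiable_normalizedExp lam a u₀ x
  obtain ⟨F, hF⟩ := exists_primitive hdiff
  have hfun : (fun u => Complex.exp (x * phase lam a u)) =
      fun u => E * normalizedExp lam a u₀ x u :=
    funext fun u => (exp_mul_normalizedExp lam a u₀ x u).symm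
  have hEF : ∀ z, HasDerivAt (fun z => E * F z) (E * normalizedExp lam a u₀ x z) z :=
    fun z => (hF z).const_mul E
  have hEc : Continuous fun z => E * normalizedExp lam a u₀ x z :=
    hdiff.continuous.const_mul E
  have hint := integrableOn_normalizedExp_ray hlam ha u₀ hx
  have hlim1 := tendsto_primitive_keyhole hEF hEc ((hint 0).const_mul E)
  have hlim2 := (tendsto_primitive_ray hF hdiff.continuous
    (hint (u₀.re + (q₁ - u₀.im)))).const_mul E
  have heq := congrArg Complex.im (tendsto_nhds_unique hlim1 hlim2)
  -- The diagonal meets the real axis at u₀.re − u₀.im; from there to 0 the unnormalized integrand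
  -- is real.
  have hreal := im_primitive_ofReal_eq hEF hEc (fun p => by
    rw [exp_mul_normalizedExp]
    have : Complex.exp (x * phase lam a p) =
        (Real.exp (x * ((Real.exp p - Real.exp (-lam * p)) / 2 - a * p)) : ℝ) := by
      simp [phase]
    rw [this, Complex.ofReal_im]) (u₀.re - u₀.im) 0
  have hd1 := integral_line_eq_sub hF hdiff.continuous u₀ (1 + Complex.I) (-u₀.im) (q₁ - u₀.im)
  have hd2 := integral_line_eq_sub hF hdiff.continuous (u₀.re + (q₁ - u₀.im) : ℝ) Complex.I q₁
    Real.pi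
  have e1 : u₀ + ((q₁ - u₀.im : ℝ) : ℂ) * (1 + Complex.I) =
      ((u₀.re + (q₁ - u₀.im) : ℝ) : ℂ) + q₁ * Complex.I := by
    apply Complex.ext <;> simp
  have e2 : u₀ + ((-u₀.im : ℝ) : ℂ) * (1 + Complex.I) = ((u₀.re - u₀.im : ℝ) : ℂ) := by
    apply Complex.ext <;> simp [sub_eq_add_neg]
  rw [e1, e2] at hd1
  rw [hfun, hd1, hd2]
  simp only [Complex.add_im] at heq
  have : ∀ X Y Z W : ℂ, (E * (X - Y + (Z - X) + W)).im = (E * (Z + W)).im - (E * Y).im :=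
    fun X Y Z W => by rw [← Complex.sub_im]; ring_nf
  rw [this]
  linarith

/-- On the ray the exponent is at most −η times x, so raising x from 1 gains a factor e^{−η(x−1)}
over the integrable case x = 1. -/
theorem isBigO_normalizedExp_ray {lam a : ℝ} (hlam : 0 < lam) (ha : 0 < a) (u₀ : ℂ) {p₁ : ℝ}
    (hlt : (phase lam a (p₁ + Real.pi * Complex.I)).re < (phase lam a u₀).re)
    (hle : ∀ p : ℝ, p₁ ≤ p → (phase lam a (p + Real.pi * Complex.I)).re ≤
      (phase lam a (p₁ + Real.pi * Complex.I)).re) :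
    ∃ η > 0, (fun x : ℝ => ∫ p in Set.Ioi p₁,
      normalizedExp lam a u₀ x (p + Real.pi * Complex.I)) =O[atTop]
        fun x => Real.exp (-η * x) := by
  set η := (phase lam a u₀).re - (phase lam a (p₁ + Real.pi * Complex.I)).re with hη
  have hη0 : 0 < η := sub_pos.2 hlt
  have hint := (integrableOn_normalizedExp_ray hlam ha u₀ one_pos p₁).norm
  refine ⟨η, hη0, IsBigO.of_bound (Real.exp η * ∫ p in Set.Ioi p₁,
    ‖normalizedExp lam a u₀ 1 (p + Real.pi * Complex.I)‖) ?_⟩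
  filter_upwards [eventually_ge_atTop 1] with x hx
  rw [Real.norm_of_nonneg (Real.exp_pos _).le]
  have h : ‖∫ p in Set.Ioi p₁, normalizedExp lam a u₀ x (p + Real.pi * Complex.I)‖ ≤
      ∫ p in Set.Ioi p₁, (Real.exp η * Real.exp (-η * x)) *
        ‖normalizedExp lam a u₀ 1 (p + Real.pi * Complex.I)‖ := by
    refine MeasureTheory.norm_integral_le_of_norm_le (hint.const_mul _) ?_
    filter_upwards [MeasureTheory.ae_restrict_mem measurableSet_Ioi] with p hp
    rw [norm_normalizedExp, norm_normalizedExp, ← Real.exp_add, ← Real.exp_add, Real.exp_le_exp]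
    have h1 := hle p (Set.mem_Ioi.1 hp).le
    nlinarith [mul_nonneg (sub_nonneg.2 hx) (sub_nonneg.2 h1)]
  refine h.trans (le_of_eq ?_)
  rw [MeasureTheory.integral_const_mul]
  ring

theorem isBigO_path_integral {lam a : ℝ} (hlam : 0 < lam) (ha : 0 < a) {u₀ : ℂ} {φ : ℂ → ℂ}
    (hu : IsSaddle lam a u₀) (h0 : 0 < u₀.im) (hlt : u₀.im < Real.pi / (1 + lam))
    (hφ : IsSaddleInversion lam a u₀ φ) (N : ℕ) :
    ∃ q₁ : ℝ, (fun x : ℝ =>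
      ((∫ t in (-u₀.im)..(q₁ - u₀.im),
            normalizedExp lam a u₀ x (u₀ + t * (1 + Complex.I)) * (1 + Complex.I)) +
          (∫ q in q₁..Real.pi,
            normalizedExp lam a u₀ x ((u₀.re + (q₁ - u₀.im) : ℝ) + q * Complex.I) * Complex.I) +
          ∫ p in Set.Ioi (u₀.re + (q₁ - u₀.im)),
            normalizedExp lam a u₀ x (p + Real.pi * Complex.I)) -
        √(2 * Real.pi / x) * ∑ k ∈ Finset.range N, (ascPochhammer ℂ k).eval (1 / 2) *
          (iteratedDeriv (2 * k) (deriv φ) 0 / ((2 * k).factorial : ℂ)) * (2 / x : ℂ) ^ k)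
      =O[atTop] fun x : ℝ => x ^ (-(N : ℝ) - 1 / 2) := by
  obtain ⟨h1, h2⟩ := lt_pi_of_le_pi_div hlam hlt.le
  obtain ⟨q₁, hq, hq1, hdiag, hvert, hray⟩ := exists_descent_path hlam ha hu h0 hlt
  refine ⟨q₁, ?_⟩
  obtain ⟨ε, hε, hεδ, hloc⟩ := isBigO_saddle_local hφ (phaseDeriv2_im_pos hlam h0 h1 h2) N
    (lt_min h0 (sub_pos.2 hq))
  obtain ⟨hε1, hε2⟩ := lt_min_iff.1 hεδ
  have hpc := (differentiable_phase lam a).continuous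
  obtain ⟨η₁, hη₁, hb1⟩ := isBigO_integral_exp_mul (a := -u₀.im) (b := -ε)
    (g := fun t : ℝ => phase lam a (u₀ + t * (1 + Complex.I)) - phase lam a u₀)
    (k := fun _ => 1 + Complex.I) (by linarith) (by fun_prop) (by fun_prop) fun t ht => by
      rw [Complex.sub_re, sub_neg]
      exact hdiag t ⟨ht.1, by linarith [ht.2]⟩ (by linarith [ht.2])
  obtain ⟨η₂, hη₂, hb2⟩ := isBigO_integral_exp_mul (a := ε) (b := q₁ - u₀.im)
    (g := fun t : ℝ => phase lam a (u₀ + t * (1 + Complex.I)) - phase lam a u₀)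
    (k := fun _ => 1 + Complex.I) (by linarith) (by fun_prop) (by fun_prop) fun t ht => by
      rw [Complex.sub_re, sub_neg]
      exact hdiag t ⟨by linarith [ht.1], ht.2⟩ (by linarith [ht.1])
  obtain ⟨η₃, hη₃, hb3⟩ := isBigO_integral_exp_mul (a := q₁) (b := Real.pi)
    (g := fun q : ℝ => phase lam a ((u₀.re + (q₁ - u₀.im) : ℝ) + q * Complex.I) - phase lam a u₀)
    (k := fun _ => Complex.I) hq1 (by fun_prop) (by fun_prop) fun q hq => by
      rw [Complex.sub_re, sub_neg]
      exact hvert q hq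
  obtain ⟨η₄, hη₄, hb4⟩ := isBigO_normalizedExp_ray hlam ha u₀ (hvert Real.pi ⟨hq1, le_rfl⟩) hray
  have hexp := fun {η : ℝ} (hη : 0 < η) => isBigO_exp_neg_mul_rpow hη (-(N : ℝ) - 1 / 2)
  refine (((((hb1.trans (hexp hη₁)).add (hb2.trans (hexp hη₂))).add
    (hb3.trans (hexp hη₃))).add (hb4.trans (hexp hη₄))).add hloc).congr_left fun x => ?_
  have hii : ∀ b c : ℝ, IntervalIntegrable (fun t : ℝ =>
      normalizedExp lam a u₀ x (u₀ + t * (1 + Complex.I)) * (1 + Complex.I))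
      MeasureTheory.volume b c := fun b c => by
    have := (differentiable_normalizedExp lam a u₀ x).continuous
    exact Continuous.intervalIntegrable (by fun_prop) _ _
  rw [← intervalIntegral.integral_add_adjacent_intervals (hii (-u₀.im) ε) (hii ε _),
    ← intervalIntegral.integral_add_adjacent_intervals (hii (-u₀.im) (-ε)) (hii (-ε) ε)]
  simp only [normalizedExp]
  ring

theorem mainTheorem2 (lam a : ℝ) (hlam : 0 < lam) (ha : 0 < a)
    (hbelow : a < (1 + lam) / 2 * lam ^ ((1 - lam) / (1 + lam))) :
    (∃! u₀ : ℂ, IsUpperSaddle lam a u₀) ∧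
    ∀ u₀ : ℂ, IsUpperSaddle lam a u₀ →
      phaseSecond lam a u₀ ≠ 0 ∧
      (∃ φ : ℂ → ℂ, IsSaddleInversion lam a u₀ φ) ∧
      ∀ φ : ℂ → ℂ, IsSaddleInversion lam a u₀ φ →
        ∀ N : ℕ,
          (fun x : ℝ => wrightMinus lam (a * x) x -
            Real.sqrt (2 / (Real.pi * x)) *
              (Complex.exp (x * phase lam a u₀) / Complex.sqrt (phaseSecond lam a u₀) *
                saddlePartialSum (saddleCoeff lam a u₀ φ) N x).re)
          =O[atTop]
          (fun x : ℝ => Real.exp (x * (phase lam a u₀).re) * x ^ (-(N : ℝ) - 1 / 2)) := by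
  refine ⟨existsUnique_isUpperSaddle hlam ha hbelow, fun u₀ hu => ?_⟩
  have hlt := isUpperSaddle_im_lt hlam ha hbelow hu
  obtain ⟨h1, h2⟩ := lt_pi_of_le_pi_div hlam hlt.le
  have him := phaseDeriv2_im_pos hlam hu.im_pos h1 h2
  refine ⟨fun h => ?_, exists_isSaddleInversion hu.saddle him, fun φ hφ N => ?_⟩
  · rw [← phaseSecond_eq lam a, h] at him
    simp at him
  obtain ⟨q₁, hO⟩ := isBigO_path_integral hlam ha hu.saddle hu.im_pos hlt hφ N
  obtain ⟨C, hC⟩ := hO.bound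
  refine IsBigO.of_bound (1 / Real.pi * C) ?_
  filter_upwards [hC, eventually_gt_atTop 0] with x hCx hx
  rw [wrightMinus_eq_keyhole hlam ha hx, keyhole_im_eq_path hlam ha u₀ hx q₁]
  set E := Complex.exp (x * phase lam a u₀) with hE
  set D : ℂ := √(2 * Real.pi / x) * ∑ k ∈ Finset.range N, (ascPochhammer ℂ k).eval (1 / 2) *
    (iteratedDeriv (2 * k) (deriv φ) 0 / ((2 * k).factorial : ℂ)) * (2 / x : ℂ) ^ k with hD
  obtain ⟨hs1, -, hs3⟩ := sqrt_neg_of_im_pos him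
  have hs0 : Complex.sqrt (-phaseDeriv2 lam u₀) ≠ 0 := fun h => by rw [h] at hs1; simp at hs1
  have hsum : saddlePartialSum (saddleCoeff lam a u₀ φ) N x =
      Complex.sqrt (-phaseDeriv2 lam u₀) * ∑ k ∈ Finset.range N,
        (ascPochhammer ℂ k).eval (1 / 2) *
          (iteratedDeriv (2 * k) (deriv φ) 0 / ((2 * k).factorial : ℂ)) * (2 / x : ℂ) ^ k := by
    rw [saddlePartialSum, Finset.mul_sum]
    refine Finset.sum_congr rfl fun k _ => ?_
    rw [saddleCoeff, phaseSecond_eq]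
    -- The sign (−1)^k in A_k cancels the one in the series, leaving the bare even Taylor
    -- coefficients of du/dw.
    have h3 : ((-1 : ℂ) ^ k) * (-1) ^ k = 1 := by rw [← mul_pow]; simp
    have h4 : (2 / x : ℂ) ^ k = 1 / ((x : ℂ) / 2) ^ k := by
      rw [one_div, ← inv_pow, inv_div]
    rw [h4]
    linear_combination (ascPochhammer ℂ k).eval (1 / 2) * Complex.sqrt (-phaseDeriv2 lam u₀) *
      (iteratedDeriv (2 * k) (deriv φ) 0 / ((2 * k).factorial : ℂ)) / ((x : ℂ) / 2) ^ k * h3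
  have hmain : √(2 / (Real.pi * x)) * (E / Complex.sqrt (phaseSecond lam a u₀) *
      saddlePartialSum (saddleCoeff lam a u₀ φ) N x).re = 1 / Real.pi * (E * D).im := by
    rw [hsum, hD, phaseSecond_eq, hs3]
    set T := ∑ k ∈ Finset.range N, (ascPochhammer ℂ k).eval (1 / 2) *
      (iteratedDeriv (2 * k) (deriv φ) 0 / ((2 * k).factorial : ℂ)) * (2 / x : ℂ) ^ k
    -- The factor √(−h₀'') from the coefficients cancels against √h₀'' = i√(−h₀''); the remaining −i
    -- turns the real part into the imaginary part of the contour integral.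
    have h5 : E / (Complex.I * Complex.sqrt (-phaseDeriv2 lam u₀)) *
        (Complex.sqrt (-phaseDeriv2 lam u₀) * T) = -Complex.I * (E * T) := by
      have := Complex.I_ne_zero
      field_simp
      rw [Complex.I_sq]
      ring
    have h6 : √(2 / (Real.pi * x)) = 1 / Real.pi * √(2 * Real.pi / x) := by
      have : 2 / (Real.pi * x) = (1 / Real.pi) ^ 2 * (2 * Real.pi / x) := by
        have := Real.pi_pos.ne'
        field_simp
      rw [this, Real.sqrt_mul (by positivity), Real.sqrt_sq (by positivity)]
    have h7 : E * (√(2 * Real.pi / x) * T) = (√(2 * Real.pi / x) : ℝ) * (E * T) := by ring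
    rw [h5, h6, h7, Complex.im_ofReal_mul, neg_mul, Complex.neg_re, Complex.I_mul_re]
    ring
  rw [hmain, ← mul_sub, ← Complex.sub_im, ← mul_sub, norm_mul, norm_mul,
    Real.norm_of_nonneg (by positivity : 0 ≤ 1 / Real.pi),
    Real.norm_of_nonneg (Real.exp_pos _).le, mul_assoc]
  refine mul_le_mul_of_nonneg_left ?_ (by positivity)
  refine (Complex.abs_im_le_norm _).trans ?_
  rw [norm_mul, hE, Complex.norm_exp, Complex.re_ofReal_mul]
  refine (mul_le_mul_of_nonneg_left hCx (Real.exp_pos _).le).trans (le_of_eq ?_)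
  ring
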